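/- For a finite tree $T$ let $|T|$ be its number of vertices, let $Z(T)$ be its $Z$-index (Hosoya index), i.e. the number of sets of edges of $T$, including the empty set, in which no two edges share a vertex, and let $W(T)$ be its Wiener index, i.e. the sum of the distances $d_T(v,w)$ over all unordered pairs of vertices $\{v,w\}$ of $T$. Put $$z_0=\frac{13\sqrt{13}-35}{72},\qquad \mathrm{WZ}(z)=\sum_T W(T)\,Z(T)\,z^{|T|},$$ where $T$ runs over all rooted ordered trees. The series $\mathrm{WZ}(z)$ converges absolutely for all complex $z$ with $|z|<z_0$, and for some $R>z_0$ its sum extends to an analytic function $\mathrm{WZ}$ on the slit disc $\{z\in\mathbb C: |z|<R\}\setminus[z_0,R)$ such that $$\mathrm{WZ}(z)\sim\frac{91-5\sqrt{13}}{1248\,(1-z/z_0)^2}\qquad\text{as } z\to z_0 \text{ within this slit disc.}$$ Moreover, if $T_n$ is chosen uniformly at random among all rooted ordered trees on $n$ vertices and $W_n=W(T_n)$, $Z_n=Z(T_n)$, then $$E(W_nZ_n)\sim\frac{(91-5\sqrt{13})\sqrt{\pi}}{312}\,n^{5/2}\left(\frac{35+13\sqrt{13}}{54}\right)^n\qquad\text{as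 } n\to\infty .$$ -/

import Mathlib

open Filter Topology Asymptotics

noncomputable section

/-- Rooted ordered (plane) trees: a root together with a finite sequence of branches. -/
inductive OrderedTree : Type
  | node (k : ℕ) (branch : Fin k → OrderedTree) : OrderedTree

namespace OrderedTree

/-- The vertices of a tree, each given by its address: the root is the empty list, and `i :: a` is
the vertex with address `a` in the `i`-th branch. -/
def verts : OrderedTree → Finset (List ℕ)
  | node _ branch =>
      insert [] (Finset.univ.biUnion fun i => (verts (branch i)).image (List.cons (i : ℕ)))

/-- The number of vertices `|T|`. -/
def order (T : OrderedTree) : ℕ := T.verts.card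

/-- The parent-child relation on addresses, symmetrized. -/
def addressGraph : SimpleGraph (List ℕ) where
  Adj u v := (∃ i, v = u ++ [i]) ∨ (∃ i, u = v ++ [i])
  symm := ⟨fun _ _ h => h.symm⟩
  loopless := ⟨fun u h => by
    rcases h with ⟨i, h⟩ | ⟨i, h⟩ <;> simpa using congrArg List.length h⟩

/-- The underlying graph of a tree: every vertex other than the root is joined to its parent. -/
def graph (T : OrderedTree) : SimpleGraph T.verts :=
  addressGraph.comap Subtype.val

theorem order_node (k : ℕ) (branch : Fin k → OrderedTree) :
    (node k branch).order = 1 + ∑ i, (branch i).order := by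
  unfold order
  rw [verts, Finset.card_insert_of_notMem (by simp), Finset.card_biUnion]
  · rw [add_comm]
    congr 1
    exact Finset.sum_congr rfl fun i _ =>
      Finset.card_image_of_injective _ (List.cons_injective)
  · intro i _ j _ hij
    rw [Function.onFun, Finset.disjoint_left]
    intro a ha hb
    simp only [Finset.mem_image] at ha hb
    obtain ⟨u, _, rfl⟩ := ha
    obtain ⟨v, _, h⟩ := hb
    exact hij (Fin.ext (List.cons.inj h).1.symm)

theorem order_pos (T : OrderedTree) : 0 < T.order := by
  cases T with
  | node k branch => rw [order_node]; omega

theorem finite_order_lt (n : ℕ) : {T : OrderedTree | T.order < n}.Finite := by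
  induction n with
  | zero => simp
  | succ n ih =>
    have hpi : ∀ k : ℕ,
        {f : Fin k → OrderedTree | ∀ i, f i ∈ {T : OrderedTree | T.order < n}}.Finite :=
      fun k => Set.Finite.pi' fun _ => ih
    refine ((Set.finite_lt_nat n).biUnion fun k _ => (hpi k).image (node k)).subset ?_
    rintro ⟨k, f⟩ hT
    rw [Set.mem_ofPred_eq, order_node] at hT
    have hk : k ≤ ∑ i, (f i).order := by
      simpa using Finset.card_nsmul_le_sum Finset.univ (fun i => (f i).order) 1
        fun i _ => order_pos (f i)
    simp only [Set.mem_iUnion, Set.mem_image]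
    refine ⟨k, ?_, f, fun i => ?_, rfl⟩
    · change k < n
      omega
    · have := Finset.single_le_sum (f := fun i => (f i).order) (fun _ _ => Nat.zero_le _)
        (Finset.mem_univ i)
      simp only [Set.mem_ofPred_eq] at this ⊢
      omega

theorem finite_order_eq (n : ℕ) : {T : OrderedTree | T.order = n}.Finite :=
  (finite_order_lt (n + 1)).subset fun T hT => by
    simp only [Set.mem_ofPred_eq] at hT ⊢
    omega

/-- The finite set of all rooted ordered trees on `n` vertices. -/
def treesOfOrder (n : ℕ) : Finset OrderedTree := (finite_order_eq n).toFinset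

/-- The expected value of `X(T_n)`, where `T_n` is uniformly distributed on the rooted ordered
trees with `n` vertices. -/
def expectation (X : OrderedTree → ℝ) (n : ℕ) : ℝ :=
  (∑ T ∈ treesOfOrder n, X T) / (treesOfOrder n).card

end OrderedTree

/-- The Hosoya index: the number of edge subsets (including the empty set) in which no two edges
share a vertex. -/
def SimpleGraph.hosoyaIndex {V : Type*} (G : SimpleGraph V) : ℕ :=
  {M : Set (Sym2 V) | M ⊆ G.edgeSet ∧ M.Pairwise fun e f => ¬ ∃ v, v ∈ e ∧ v ∈ f}.ncard

/-- The Wiener index: the sum of the distances over all unordered pairs of vertices (a pair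
`s(v, v)` contributes `0`). -/
def SimpleGraph.wienerIndex {V : Type*} [Fintype V] [DecidableEq V] (G : SimpleGraph V) : ℕ :=
  ∑ p : Sym2 V, Sym2.lift ⟨fun v w => G.dist v w, fun _ _ => G.dist_comm⟩ p

namespace OrderedTree

/-- The `Z`-index of a tree. -/
def Z (T : OrderedTree) : ℕ := T.graph.hosoyaIndex

/-- The Wiener index of a tree. -/
def W (T : OrderedTree) : ℕ := T.graph.wienerIndex

end OrderedTree

/-- The dominating singularity `z_0`. -/
def z₀ : ℝ := (13 * √13 - 35) / 72

/-- The open disc of radius `R` about `0`, slit along the real ray from `r` to the right. -/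
def slitDisc (r R : ℝ) : Set ℂ :=
  {z | ‖z‖ < R ∧ ¬ (z.im = 0 ∧ r ≤ z.re)}

end

/-!
Every plane tree other than a single vertex arises in one way by attaching a tree `B` as last branch
to the root of a tree `T` (`graftEquiv`); the underlying graph is then the union of the two graphs
with an edge between the roots (`graftIso`). Hence the order, the number `Z` of matchings, the number
`rootFreeZ` of matchings avoiding the root, the sum `rootDist` of the distances from the root and `W`
satisfy bilinear recursions (`Z_graft`, `rootFreeZ_graft`, `rootDist_graft`, `W_graft`).

The generating functions `A`, `B` of `Z` and `rootFreeZ` therefore satisfy `A = z + A² + B²` and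
`B = z + A B`, a curve uniformized by `s = B / (1 - A)`, with `z = s / (1 + s + s²)²`. The generating
functions weighted by order, `rootDist` and `W` solve linear systems with the same matrix, whose
determinant is `(1 - s - 3 s²) / (1 + s + s²)²`. Their right-hand sides are built from the series
already found, so the poles at the zero `s₀ = (√13 - 1) / 6` of `1 - s - 3 s²` have orders one and two
for order and `rootDist`, and four for `W` (`solWZ_eq`). Absolute convergence for `‖z‖ < z₀` follows
since, for real parameters, the closed forms dominate all partial sums (`partialSum_le`,
`hasSum_term_W_mul_Z`).

On the closed disc `‖s‖ ≤ s₀` the map `s ↦ z` is injective, and `1 - z / z₀` has there an analytic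
square root `uOf` with nonvanishing derivative. So `uOf` has an analytic inverse on a neighbourhood
of a closed lobe of the lemniscate domain `‖1 - u²‖ ≤ 1`, and substituting `u = √(1 - z / z₀)`
inverts `s ↦ z` on a slit disc of radius `R > z₀` (`exists_inverse_zOf`). The fourth-order pole in
`s` becomes a double pole in `1 - z / z₀` (`exists_extension`).

For the coefficients, the comparison series `c w / (1 - w)²` with `w = z / z₀` is subtracted; the
difference is at most `ε ‖1 - w‖⁻² + C` in the open disc. Cauchy's formula on the circle of radius
`1 - 1 / (2 n)`, where the mean of `‖1 - w‖⁻²` is a value of the Poisson integral, shows that its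
coefficients are `o(n)` (`tendsto_coeff_of_double_pole`). Dividing by the number of trees, a Catalan
number, gives the expectation.
-/

noncomputable section

/-! ### Joining two graphs by an edge -/

namespace SimpleGraph

variable {V W : Type*}

/-- The sets of pairwise disjoint edges of `G`. -/
def matchings (G : SimpleGraph V) : Set (Set (Sym2 V)) :=
  {M | M ⊆ G.edgeSet ∧ M.Pairwise fun e f => ¬ ∃ v, v ∈ e ∧ v ∈ f}

/-- The matchings of `G` that leave the vertex `r` uncovered. -/
def matchingsAvoiding (G : SimpleGraph V) (r : V) : Set (Set (Sym2 V)) :=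
  {M ∈ G.matchings | ∀ e ∈ M, r ∉ e}

/-- The graph obtained from disjoint copies of `G` and `H` by joining `r` to `s`. -/
def join (G : SimpleGraph V) (H : SimpleGraph W) (r : V) (s : W) : SimpleGraph (V ⊕ W) :=
  (G ⊕g H) ⊔ edge (Sum.inl r) (Sum.inr s)

section join

variable (G : SimpleGraph V) (H : SimpleGraph W) (r : V) (s : W)

@[simp] theorem join_adj_inl_inl (v v' : V) :
    (G.join H r s).Adj (Sum.inl v) (Sum.inl v') ↔ G.Adj v v' := by
  simp [join, edge_adj]

@[simp] theorem join_adj_inr_inr (w w' : W) :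
    (G.join H r s).Adj (Sum.inr w) (Sum.inr w') ↔ H.Adj w w' := by
  simp [join, edge_adj]

@[simp] theorem join_adj_inl_inr (v : V) (w : W) :
    (G.join H r s).Adj (Sum.inl v) (Sum.inr w) ↔ v = r ∧ w = s := by
  simp [join, edge_adj, eq_comm]

@[simp] theorem join_adj_inr_inl (v : V) (w : W) :
    (G.join H r s).Adj (Sum.inr w) (Sum.inl v) ↔ v = r ∧ w = s := by
  rw [adj_comm, join_adj_inl_inr]

theorem mem_edgeSet_join (e : Sym2 (V ⊕ W)) :
    e ∈ (G.join H r s).edgeSet ↔ (∃ f ∈ G.edgeSet, f.map Sum.inl = e) ∨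
      (∃ f ∈ H.edgeSet, f.map Sum.inr = e) ∨ e = s(Sum.inl r, Sum.inr s) := by
  induction e with | _ x y
  constructor
  · intro h
    rcases x with v | w <;> rcases y with v' | w' <;> simp only [mem_edgeSet, join_adj_inl_inl,
      join_adj_inr_inr, join_adj_inl_inr, join_adj_inr_inl] at h
    · exact Or.inl ⟨s(v, v'), h, rfl⟩
    · exact Or.inr (Or.inr (by rw [h.1, h.2]))
    · exact Or.inr (Or.inr (by rw [h.1, h.2, Sym2.eq_swap]))
    · exact Or.inr (Or.inl ⟨s(w, w'), h, rfl⟩)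
  · rintro (⟨f, hf, h⟩ | ⟨f, hf, h⟩ | h)
    · induction f with | _ v v'
      rw [← h]; simpa using hf
    · induction f with | _ v v'
      rw [← h]; simpa using hf
    · rw [h]; simp

/-- The edge set of `G.join H r s` formed by edge sets of the two parts. -/
def unionMap (p : Set (Sym2 V) × Set (Sym2 W)) : Set (Sym2 (V ⊕ W)) :=
  Sym2.map Sum.inl '' p.1 ∪ Sym2.map Sum.inr '' p.2

theorem map_inl_ne_map_inr (e : Sym2 V) (f : Sym2 W) :
    e.map (Sum.inl : V → V ⊕ W) ≠ f.map Sum.inr := by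
  induction e with | _ a b
  induction f with | _ c d
  simp

theorem map_inl_ne_mk (e : Sym2 V) :
    e.map (Sum.inl : V → V ⊕ W) ≠ s(Sum.inl r, Sum.inr s) := by
  induction e with | _ a b
  simp

theorem map_inr_ne_mk (e : Sym2 W) :
    e.map (Sum.inr : W → V ⊕ W) ≠ s(Sum.inl r, Sum.inr s) := by
  induction e with | _ a b
  simp

theorem mem_unionMap_inl (p : Set (Sym2 V) × Set (Sym2 W)) (e : Sym2 V) :
    e.map Sum.inl ∈ unionMap p ↔ e ∈ p.1 := by
  constructor
  · rintro (⟨f, hf, h⟩ | ⟨f, hf, h⟩)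
    · rwa [← Sym2.map.injective Sum.inl_injective h]
    · exact absurd h.symm (map_inl_ne_map_inr e f)
  · exact fun h => Or.inl ⟨e, h, rfl⟩

theorem mem_unionMap_inr (p : Set (Sym2 V) × Set (Sym2 W)) (e : Sym2 W) :
    e.map Sum.inr ∈ unionMap p ↔ e ∈ p.2 := by
  constructor
  · rintro (⟨f, hf, h⟩ | ⟨f, hf, h⟩)
    · exact absurd h (map_inl_ne_map_inr f e)
    · rwa [← Sym2.map.injective Sum.inr_injective h]
  · exact fun h => Or.inr ⟨e, h, rfl⟩

theorem mk_notMem_unionMap (p : Set (Sym2 V) × Set (Sym2 W)) :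
    s(Sum.inl r, Sum.inr s) ∉ unionMap p := by
  rintro (⟨f, -, h⟩ | ⟨f, -, h⟩)
  · exact map_inl_ne_mk r s f h
  · exact map_inr_ne_mk r s f h

theorem unionMap_injective : Function.Injective (unionMap (V := V) (W := W)) := by
  intro p p' h
  ext e
  · rw [← mem_unionMap_inl, h, mem_unionMap_inl]
  · rw [← mem_unionMap_inr, h, mem_unionMap_inr]

theorem exists_mem_map_inl {e f : Sym2 V} :
    (∃ x : V ⊕ W, x ∈ e.map Sum.inl ∧ x ∈ f.map Sum.inl) ↔ ∃ v, v ∈ e ∧ v ∈ f := by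
  simp only [Sym2.mem_map]
  constructor
  · rintro ⟨x, ⟨a, ha, rfl⟩, b, hb, h⟩
    exact ⟨a, ha, Sum.inl_injective h ▸ hb⟩
  · rintro ⟨v, h, h'⟩
    exact ⟨_, ⟨v, h, rfl⟩, v, h', rfl⟩

theorem exists_mem_map_inr {e f : Sym2 W} :
    (∃ x : V ⊕ W, x ∈ e.map Sum.inr ∧ x ∈ f.map Sum.inr) ↔ ∃ v, v ∈ e ∧ v ∈ f := by
  simp only [Sym2.mem_map]
  constructor
  · rintro ⟨x, ⟨a, ha, rfl⟩, b, hb, h⟩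
    exact ⟨a, ha, Sum.inr_injective h ▸ hb⟩
  · rintro ⟨v, h, h'⟩
    exact ⟨_, ⟨v, h, rfl⟩, v, h', rfl⟩

theorem unionMap_mem_matchings (p : Set (Sym2 V) × Set (Sym2 W)) :
    unionMap p ∈ (G.join H r s).matchings ↔ p.1 ∈ G.matchings ∧ p.2 ∈ H.matchings := by
  constructor
  · rintro ⟨h1, h2⟩
    refine ⟨⟨fun e he => ?_, fun e he f hf hne hv => ?_⟩, fun e he => ?_,
      fun e he f hf hne hv => ?_⟩
    · rcases (mem_edgeSet_join ..).1 (h1 ((mem_unionMap_inl p e).2 he)) with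
        ⟨f, hf, h⟩ | ⟨f, hf, h⟩ | h
      · rwa [← Sym2.map.injective Sum.inl_injective h]
      · exact absurd h.symm (map_inl_ne_map_inr e f)
      · exact absurd h (map_inl_ne_mk r s e)
    · exact h2 ((mem_unionMap_inl p e).2 he) ((mem_unionMap_inl p f).2 hf)
        ((Sym2.map.injective Sum.inl_injective).ne hne) (exists_mem_map_inl.2 hv)
    · rcases (mem_edgeSet_join ..).1 (h1 ((mem_unionMap_inr p e).2 he)) with
        ⟨f, hf, h⟩ | ⟨f, hf, h⟩ | h
      · exact absurd h (map_inl_ne_map_inr f e)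
      · rwa [← Sym2.map.injective Sum.inr_injective h]
      · exact absurd h (map_inr_ne_mk r s e)
    · exact h2 ((mem_unionMap_inr p e).2 he) ((mem_unionMap_inr p f).2 hf)
        ((Sym2.map.injective Sum.inr_injective).ne hne) (exists_mem_map_inr.2 hv)
  · rintro ⟨⟨h1, h2⟩, h3, h4⟩
    refine ⟨?_, ?_⟩
    · rintro _ (⟨e, he, rfl⟩ | ⟨e, he, rfl⟩)
      · exact (mem_edgeSet_join ..).2 (Or.inl ⟨e, h1 he, rfl⟩)
      · exact (mem_edgeSet_join ..).2 (Or.inr (Or.inl ⟨e, h3 he, rfl⟩))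
    · rintro _ (⟨e, he, rfl⟩ | ⟨e, he, rfl⟩) _ (⟨f, hf, rfl⟩ | ⟨f, hf, rfl⟩) hne
      · rw [exists_mem_map_inl]
        exact h2 he hf fun h => hne (h ▸ rfl)
      · simp only [Sym2.mem_map]
        rintro ⟨x, ⟨a, -, rfl⟩, b, -, h⟩
        cases h
      · simp only [Sym2.mem_map]
        rintro ⟨x, ⟨a, -, rfl⟩, b, -, h⟩
        cases h
      · rw [exists_mem_map_inr]
        exact h4 he hf fun h => hne (h ▸ rfl)

/-- An edge set of the join is determined, up to the joining edge, by its traces on the two parts. -/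
theorem eq_unionMap {M : Set (Sym2 (V ⊕ W))} (hM : M ⊆ (G.join H r s).edgeSet) :
    M \ {s(Sum.inl r, Sum.inr s)} =
      unionMap (Sym2.map Sum.inl ⁻¹' M, Sym2.map Sum.inr ⁻¹' M) := by
  ext e
  constructor
  · rintro ⟨he, hne⟩
    rcases (mem_edgeSet_join ..).1 (hM he) with ⟨f, hf, rfl⟩ | ⟨f, hf, rfl⟩ | h
    · exact Or.inl ⟨f, he, rfl⟩
    · exact Or.inr ⟨f, he, rfl⟩
    · exact absurd h hne
  · rintro (⟨f, hf, rfl⟩ | ⟨f, hf, rfl⟩)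
    · exact ⟨hf, map_inl_ne_mk r s f⟩
    · exact ⟨hf, map_inr_ne_mk r s f⟩

/-- A matching may contain the joining edge exactly when it leaves `r` and `s` uncovered otherwise. -/
theorem insert_unionMap_mem_matchings (p : Set (Sym2 V) × Set (Sym2 W)) :
    insert s(Sum.inl r, Sum.inr s) (unionMap p) ∈ (G.join H r s).matchings ↔
      p.1 ∈ G.matchingsAvoiding r ∧ p.2 ∈ H.matchingsAvoiding s := by
  have hne : ∀ e ∈ unionMap p, s(Sum.inl r, Sum.inr s) ≠ e :=
    fun e he h => mk_notMem_unionMap r s p (h ▸ he)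
  constructor
  · rintro ⟨h1, h2⟩
    have h := (unionMap_mem_matchings G H r s p).1
      ⟨(Set.subset_insert _ _).trans h1, h2.mono (Set.subset_insert _ _)⟩
    refine ⟨⟨h.1, fun e he hr => ?_⟩, h.2, fun e he hs => ?_⟩
    · have he' := (mem_unionMap_inl p e).2 he
      exact h2 (Set.mem_insert _ _) (Set.mem_insert_of_mem _ he') (hne _ he')
        ⟨Sum.inl r, by simp, Sym2.mem_map.2 ⟨r, hr, rfl⟩⟩
    · have he' := (mem_unionMap_inr p e).2 he
      exact h2 (Set.mem_insert _ _) (Set.mem_insert_of_mem _ he') (hne _ he')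
        ⟨Sum.inr s, by simp, Sym2.mem_map.2 ⟨s, hs, rfl⟩⟩
  · rintro ⟨⟨h1, h1'⟩, h2, h2'⟩
    have h := (unionMap_mem_matchings G H r s p).2 ⟨h1, h2⟩
    refine ⟨Set.insert_subset ((mem_edgeSet_join ..).2 (Or.inr (Or.inr rfl))) h.1, ?_⟩
    have : Std.Symm fun e f : Sym2 (V ⊕ W) => ¬ ∃ v, v ∈ e ∧ v ∈ f :=
      ⟨fun e f h h' => h (by simpa only [and_comm] using h')⟩
    refine h.2.insert_of_symm ?_
    rintro _ (⟨e, he, rfl⟩ | ⟨e, he, rfl⟩) -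
    · rintro ⟨v, hv, hv'⟩
      obtain ⟨a, ha, rfl⟩ := Sym2.mem_map.1 hv'
      simp only [Sym2.mem_iff, Sum.inl.injEq, reduceCtorEq, or_false] at hv
      exact h1' e he (hv ▸ ha)
    · rintro ⟨v, hv, hv'⟩
      obtain ⟨a, ha, rfl⟩ := Sym2.mem_map.1 hv'
      simp only [Sym2.mem_iff, Sum.inr.injEq, reduceCtorEq, false_or] at hv
      exact h2' e he (hv ▸ ha)

theorem matchings_join : (G.join H r s).matchings =
    unionMap '' (G.matchings ×ˢ H.matchings) ∪
      (fun p => insert s(Sum.inl r, Sum.inr s) (unionMap p)) ''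
        (G.matchingsAvoiding r ×ˢ H.matchingsAvoiding s) := by
  ext M
  constructor
  · intro hM
    have h := eq_unionMap G H r s hM.1
    by_cases he : s(Sum.inl r, Sum.inr s) ∈ M
    · have hM' := congrArg (insert s(Sum.inl r, Sum.inr s)) h
      rw [Set.insert_sdiff_singleton, Set.insert_eq_of_mem he] at hM'
      exact Or.inr ⟨_, (insert_unionMap_mem_matchings G H r s _).1 (hM' ▸ hM), hM'.symm⟩
    · rw [Set.sdiff_singleton_eq_self he] at h
      exact Or.inl ⟨_, (unionMap_mem_matchings G H r s _).1 (h ▸ hM), h.symm⟩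
  · rintro (⟨p, hp, rfl⟩ | ⟨p, hp, rfl⟩)
    · exact (unionMap_mem_matchings G H r s p).2 hp
    · exact (insert_unionMap_mem_matchings G H r s p).2 hp

theorem matchingsAvoiding_join : (G.join H r s).matchingsAvoiding (Sum.inl r) =
    unionMap '' (G.matchingsAvoiding r ×ˢ H.matchings) := by
  ext M
  constructor
  · rintro ⟨hM, hr⟩
    rw [matchings_join] at hM
    rcases hM with ⟨p, hp, rfl⟩ | ⟨p, hp, rfl⟩
    · exact ⟨p, ⟨⟨hp.1, fun e he h => hr _ ((mem_unionMap_inl p e).2 he)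
        (Sym2.mem_map.2 ⟨r, h, rfl⟩)⟩, hp.2⟩, rfl⟩
    · exact absurd (by simp) (hr _ (Set.mem_insert _ _))
  · rintro ⟨p, ⟨⟨h1, h1'⟩, h2⟩, rfl⟩
    refine ⟨(unionMap_mem_matchings G H r s p).2 ⟨h1, h2⟩, ?_⟩
    rintro _ (⟨e, he, rfl⟩ | ⟨e, he, rfl⟩) h
    · obtain ⟨a, ha, h⟩ := Sym2.mem_map.1 h
      exact h1' e he (Sum.inl_injective h ▸ ha)
    · obtain ⟨a, ha, h⟩ := Sym2.mem_map.1 h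
      cases h

theorem hosoyaIndex_join [Finite V] [Finite W] : (G.join H r s).hosoyaIndex =
    G.hosoyaIndex * H.hosoyaIndex +
      (G.matchingsAvoiding r).ncard * (H.matchingsAvoiding s).ncard := by
  change (G.join H r s).matchings.ncard = G.matchings.ncard * H.matchings.ncard + _
  have hdisj : Disjoint (unionMap '' (G.matchings ×ˢ H.matchings))
      ((fun p => insert s(Sum.inl r, Sum.inr s) (unionMap p)) ''
        (G.matchingsAvoiding r ×ˢ H.matchingsAvoiding s)) := by
    rw [Set.disjoint_left]
    rintro _ ⟨p, -, rfl⟩ ⟨p', -, h⟩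
    exact mk_notMem_unionMap r s p (h ▸ Set.mem_insert _ _)
  have hinj : Function.Injective fun p : Set (Sym2 V) × Set (Sym2 W) =>
      insert (s(Sum.inl r, Sum.inr s) : Sym2 (V ⊕ W)) (unionMap p) := by
    intro p p' h
    apply unionMap_injective
    rw [← Set.insert_sdiff_self_of_notMem (mk_notMem_unionMap r s p),
      ← Set.insert_sdiff_self_of_notMem (mk_notMem_unionMap r s p')]
    exact congrArg (· \ _) h
  rw [matchings_join, Set.ncard_union_eq hdisj,
    Set.ncard_image_of_injective _ unionMap_injective, Set.ncard_image_of_injective _ hinj,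
    Set.ncard_prod, Set.ncard_prod]

theorem ncard_matchingsAvoiding_join :
    ((G.join H r s).matchingsAvoiding (Sum.inl r)).ncard =
      (G.matchingsAvoiding r).ncard * H.hosoyaIndex := by
  rw [matchingsAvoiding_join, Set.ncard_image_of_injective _ unionMap_injective, Set.ncard_prod]
  rfl

end join

section Iso

variable {G : SimpleGraph V} {H : SimpleGraph W}

theorem Iso.image_mem_matchings (φ : G ≃g H) {M : Set (Sym2 V)} (hM : M ∈ G.matchings) :
    Sym2.map φ '' M ∈ H.matchings := by
  refine ⟨?_, ?_⟩
  · rintro _ ⟨e, he, rfl⟩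
    have := hM.1 he
    induction e with | _ a b
    exact φ.map_rel_iff.2 this
  · rintro _ ⟨e, he, rfl⟩ _ ⟨f, hf, rfl⟩ hne ⟨v, hv, hv'⟩
    obtain ⟨a, ha, rfl⟩ := Sym2.mem_map.1 hv
    obtain ⟨b, hb, h⟩ := Sym2.mem_map.1 hv'
    exact hM.2 he hf (fun h => hne (h ▸ rfl)) ⟨a, ha, φ.injective h ▸ hb⟩

theorem Iso.image_mem_matchingsAvoiding (φ : G ≃g H) {r : V} {M : Set (Sym2 V)}
    (hM : M ∈ G.matchingsAvoiding r) : Sym2.map φ '' M ∈ H.matchingsAvoiding (φ r) := by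
  refine ⟨φ.image_mem_matchings hM.1, ?_⟩
  rintro _ ⟨e, he, rfl⟩ h
  obtain ⟨a, ha, h⟩ := Sym2.mem_map.1 h
  exact hM.2 e he (φ.injective h ▸ ha)

theorem Iso.image_image_symm (φ : G ≃g H) (M : Set (Sym2 W)) :
    Sym2.map φ '' (Sym2.map φ.symm '' M) = M := by
  rw [← Set.image_comp, ← Sym2.map_comp]
  have : (φ ∘ φ.symm : W → W) = id := funext φ.apply_symm_apply
  rw [this, Sym2.map_id, Set.image_id]

theorem Iso.hosoyaIndex_eq (φ : G ≃g H) : G.hosoyaIndex = H.hosoyaIndex := by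
  change G.matchings.ncard = H.matchings.ncard
  rw [← Set.ncard_image_of_injective G.matchings (Sym2.map.injective φ.injective).image_injective]
  congr 1
  ext M
  exact ⟨fun ⟨N, hN, h⟩ => h ▸ φ.image_mem_matchings hN,
    fun h => ⟨_, φ.symm.image_mem_matchings h, φ.image_image_symm M⟩⟩

theorem Iso.ncard_matchingsAvoiding_eq (φ : G ≃g H) (r : V) :
    (G.matchingsAvoiding r).ncard = (H.matchingsAvoiding (φ r)).ncard := by
  rw [← Set.ncard_image_of_injective (G.matchingsAvoiding r)
    (Sym2.map.injective φ.injective).image_injective]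
  congr 1
  ext M
  refine ⟨fun ⟨N, hN, h⟩ => h ▸ φ.image_mem_matchingsAvoiding hN,
    fun h => ⟨_, ?_, φ.image_image_symm M⟩⟩
  simpa using φ.symm.image_mem_matchingsAvoiding h

theorem Iso.dist_eq (φ : G ≃g H) (u v : V) : H.dist (φ u) (φ v) = G.dist u v := by
  by_cases h : G.Reachable u v
  · apply le_antisymm
    · obtain ⟨p, hp⟩ := h.exists_walk_length_eq_dist
      simpa [hp] using dist_le (p.map φ.toHom)
    · obtain ⟨p, hp⟩ := (φ.reachable_iff.2 h).exists_walk_length_eq_dist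
      have := dist_le ((p.map φ.symm.toHom).copy (φ.symm_apply_apply u) (φ.symm_apply_apply v))
      simpa [hp] using this
  · rw [dist_eq_zero_of_not_reachable h,
      dist_eq_zero_of_not_reachable (fun h' => h (φ.reachable_iff.1 h'))]

end Iso

section Wiener

/-- Each unordered pair of distinct vertices arises from two ordered pairs. -/
theorem sum_sum_dist_eq [Fintype V] [DecidableEq V] (G : SimpleGraph V) :
    ∑ v, ∑ w, G.dist v w = 2 * G.wienerIndex := by
  rw [wienerIndex, Finset.mul_sum, ← Finset.sum_product',
    ← Finset.sum_fiberwise (s := Finset.univ ×ˢ Finset.univ) (g := fun x : V × V => s(x.1, x.2))]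
  refine Finset.sum_congr rfl fun e _ => ?_
  induction e with | _ a b
  by_cases hab : a = b
  · subst hab
    rw [Finset.sum_eq_zero]
    · simp
    · rintro ⟨x, y⟩ hx
      simp only [Finset.mem_filter, Sym2.eq_iff] at hx
      obtain ⟨rfl, rfl⟩ | ⟨rfl, rfl⟩ := hx.2 <;> simp
  · have : ((Finset.univ ×ˢ Finset.univ : Finset (V × V)).filter
        fun x => s(x.1, x.2) = s(a, b)) = {(a, b), (b, a)} := by
      ext ⟨x, y⟩
      simp
    rw [this, Finset.sum_pair (by simpa using fun h _ => hab h)]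
    simp [G.dist_comm (u := b), two_mul]

/-- A function changing by at most one along each edge bounds distances from below. -/
theorem Connected.le_add_dist {G : SimpleGraph V} (hG : G.Connected) (f : V → ℕ)
    (hf : ∀ u v, G.Adj u v → f v ≤ f u + 1) (u v : V) : f v ≤ f u + G.dist u v := by
  obtain ⟨p, hp⟩ := hG.exists_walk_length_eq_dist u v
  rw [← hp]
  clear hp
  induction p with
  | nil => simp
  | cons h p ih =>
    have := hf _ _ h
    rw [Walk.length_cons]
    omega

variable {G : SimpleGraph V} {H : SimpleGraph W}

/-- The symmetry of the construction of `join` in its two parts. -/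
def joinComm (r : V) (s : W) : G.join H r s ≃g H.join G s r where
  toEquiv := Equiv.sumComm V W
  map_rel_iff' := by
    rintro (a | a) (b | b) <;> simp [and_comm]

theorem Connected.dist_adj_le (hG : G.Connected) (a : V) {u v : V} (h : G.Adj u v) :
    G.dist a v ≤ G.dist a u + 1 := by
  have := hG.dist_triangle (u := a) (v := u) (w := v)
  rwa [dist_eq_one_iff_adj.2 h] at this

theorem connected_join (hG : G.Connected) (hH : H.Connected) (r : V) (s : W) :
    (G.join H r s).Connected := hG.sum_sup_edge hH

/-- Lower bounds for distances in the join: the claimed distances from `a` change by at most one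
along each edge. -/
theorem dist_join_le (hG : G.Connected) (hH : H.Connected) (r : V) (s : W) (a : V) :
    (∀ b, G.dist a b ≤ (G.join H r s).dist (Sum.inl a) (Sum.inl b)) ∧
    ∀ w, G.dist a r + 1 + H.dist s w ≤ (G.join H r s).dist (Sum.inl a) (Sum.inr w) := by
  have key := (connected_join hG hH r s).le_add_dist
    (Sum.elim (fun b => G.dist a b) fun w => G.dist a r + 1 + H.dist s w) (by
      rintro (u | u) (v | v) h <;> simp only [join_adj_inl_inl, join_adj_inr_inr,
        join_adj_inl_inr, join_adj_inr_inl] at h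
      · exact hG.dist_adj_le a h
      · obtain ⟨rfl, rfl⟩ := h
        simp
      · obtain ⟨rfl, rfl⟩ := h
        simp; omega
      · have := hH.dist_adj_le s h
        simp only [Sum.elim_inr]
        omega) (Sum.inl a)
  exact ⟨fun b => by simpa using key (Sum.inl b), fun w => by simpa using key (Sum.inr w)⟩

theorem dist_join_inl_inl (hG : G.Connected) (hH : H.Connected) (r : V) (s : W) (a b : V) :
    (G.join H r s).dist (Sum.inl a) (Sum.inl b) = G.dist a b := by
  refine le_antisymm ?_ ((dist_join_le hG hH r s a).1 b)
  obtain ⟨p, hp⟩ := hG.exists_walk_length_eq_dist a b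
  let φ : G →g G.join H r s := ⟨Sum.inl, fun h => by simpa using h⟩
  rw [← hp, ← Walk.length_map φ p]
  exact dist_le (p.map φ)

theorem dist_join_inr_inr (hG : G.Connected) (hH : H.Connected) (r : V) (s : W) (a b : W) :
    (G.join H r s).dist (Sum.inr a) (Sum.inr b) = H.dist a b := by
  rw [← (joinComm r s).dist_eq]
  exact dist_join_inl_inl hH hG s r a b

theorem dist_join_inl_inr (hG : G.Connected) (hH : H.Connected) (r : V) (s : W) (a : V) (w : W) :
    (G.join H r s).dist (Sum.inl a) (Sum.inr w) = G.dist r a + 1 + H.dist s w := by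
  have hc := connected_join hG hH r s
  rw [G.dist_comm (u := r)]
  refine le_antisymm ?_ ((dist_join_le hG hH r s a).2 w)
  have h1 := hc.dist_triangle (u := Sum.inl a) (v := Sum.inl r) (w := Sum.inr w)
  have h2 := hc.dist_triangle (u := Sum.inl r) (v := Sum.inr s) (w := Sum.inr w)
  rw [dist_join_inl_inl hG hH] at h1
  rw [dist_join_inr_inr hG hH, dist_eq_one_iff_adj.2 ((join_adj_inl_inr ..).2 ⟨rfl, rfl⟩)] at h2
  omega

theorem wienerIndex_join [Fintype V] [DecidableEq V] [Fintype W] [DecidableEq W]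
    (hG : G.Connected) (hH : H.Connected) (r : V) (s : W) :
    (G.join H r s).wienerIndex = G.wienerIndex + H.wienerIndex +
      (Fintype.card V * (∑ w, H.dist s w) + Fintype.card V * Fintype.card W +
        Fintype.card W * ∑ v, G.dist r v) := by
  apply Nat.eq_of_mul_eq_mul_left two_pos
  rw [← sum_sum_dist_eq, Fintype.sum_sum_type]
  simp only [Fintype.sum_sum_type, dist_join_inl_inl hG hH, dist_join_inr_inr hG hH,
    (G.join H r s).dist_comm (u := Sum.inr _) (v := Sum.inl _), dist_join_inl_inr hG hH,
    Finset.sum_add_distrib, Finset.sum_const, smul_eq_mul, sum_sum_dist_eq, Finset.card_univ,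
    ← Finset.mul_sum]
  ring

theorem Iso.wienerIndex_eq [Fintype V] [DecidableEq V] [Fintype W] [DecidableEq W]
    (φ : G ≃g H) : G.wienerIndex = H.wienerIndex := by
  apply Nat.eq_of_mul_eq_mul_left two_pos
  rw [← sum_sum_dist_eq, ← sum_sum_dist_eq, ← φ.toEquiv.sum_comp]
  refine Finset.sum_congr rfl fun v _ => ?_
  rw [← φ.toEquiv.sum_comp]
  exact Finset.sum_congr rfl fun w _ => (φ.dist_eq v w).symm

end Wiener

end SimpleGraph

/-! ### Grafting plane trees -/

namespace OrderedTree

/-- The tree with a single vertex. -/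
def leaf : OrderedTree := node 0 Fin.elim0

/-- The number of branches at the root. -/
def arity : OrderedTree → ℕ
  | node k _ => k

/-- The tree obtained from `T` by attaching `B` as a new last branch at the root. As the last
branch, it leaves the addresses of the vertices of `T` unchanged. -/
def graft : OrderedTree → OrderedTree → OrderedTree
  | node k f, B => node (k + 1) (Fin.snoc (α := fun _ => OrderedTree) f B)

theorem node_zero (f : Fin 0 → OrderedTree) : node 0 f = leaf := by
  rw [leaf, Subsingleton.elim f Fin.elim0]

theorem node_succ (k : ℕ) (f : Fin (k + 1) → OrderedTree) :
    node (k + 1) f = graft (node k fun i => f i.castSucc) (f (Fin.last k)) := by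
  rw [graft]
  congr 1
  exact (Fin.snoc_init_self (α := fun _ => OrderedTree) f).symm

/-- Every tree arises from `leaf` by grafting. -/
theorem graft_induction {P : OrderedTree → Prop} (h0 : P leaf)
    (h1 : ∀ T B, P T → P B → P (graft T B)) (T : OrderedTree) : P T := by
  induction T with
  | node k f ih =>
    induction k with
    | zero => rw [node_zero]; exact h0
    | succ k ihk =>
      rw [node_succ]
      exact h1 _ _ (ihk _ fun i => ih _) (ih _)

theorem graft_ne_leaf (T B : OrderedTree) : graft T B ≠ leaf := by
  cases T with
  | node k f => rw [graft, leaf]; simp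

theorem graft_injective {T T' B B' : OrderedTree} (h : graft T B = graft T' B') :
    T = T' ∧ B = B' := by
  cases T with | node k f
  cases T' with | node k' f'
  rw [graft, graft] at h
  injection h with hk hf
  obtain rfl : k = k' := by omega
  have := Fin.snoc_injective2 (α := fun _ => OrderedTree) (eq_of_heq hf)
  exact ⟨by rw [this.1], this.2⟩

/-- The decomposition of a tree other than `leaf` into its last branch and the rest. -/
def graftEquiv : Option (OrderedTree × OrderedTree) ≃ OrderedTree :=
  Equiv.ofBijective (fun o => o.elim leaf fun p => graft p.1 p.2) <| by
    constructor
    · rintro (_ | ⟨T, B⟩) (_ | ⟨T', B'⟩) h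
      · rfl
      · exact absurd h.symm (graft_ne_leaf _ _)
      · exact absurd h (graft_ne_leaf _ _)
      · obtain ⟨rfl, rfl⟩ := graft_injective h
        rfl
    · intro T
      induction T using graft_induction with
      | h0 => exact ⟨none, rfl⟩
      | h1 T B => exact ⟨some (T, B), rfl⟩

theorem nil_mem_verts (T : OrderedTree) : [] ∈ T.verts := by
  cases T with | node k f
  simp [verts]

theorem cons_mem_verts_node {k : ℕ} {f : Fin k → OrderedTree} {i : ℕ} {a : List ℕ} :
    i :: a ∈ (node k f).verts ↔ ∃ h : i < k, a ∈ (f ⟨i, h⟩).verts := by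
  rw [verts]
  simp only [Finset.mem_insert, reduceCtorEq, Finset.mem_biUnion, Finset.mem_univ,
    Finset.mem_image, List.cons.injEq, true_and, false_or]
  constructor
  · rintro ⟨j, b, hb, rfl, rfl⟩
    exact ⟨j.2, hb⟩
  · rintro ⟨h, ha⟩
    exact ⟨⟨i, h⟩, a, ha, rfl, rfl⟩

theorem lt_arity {T : OrderedTree} {i : ℕ} {a : List ℕ} (h : i :: a ∈ T.verts) : i < T.arity := by
  cases T with | node k f
  exact (cons_mem_verts_node.1 h).1

theorem verts_graft (T B : OrderedTree) :
    (graft T B).verts = T.verts ∪ B.verts.image (List.cons T.arity) := by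
  cases T with | node k f
  ext v
  rcases v with _ | ⟨i, a⟩
  · simp [nil_mem_verts]
  · rw [graft, cons_mem_verts_node, Finset.mem_union, cons_mem_verts_node]
    simp only [Finset.mem_image, List.cons.injEq, arity]
    constructor
    · rintro ⟨h, ha⟩
      rcases Nat.lt_succ_iff_lt_or_eq.1 h with hi | rfl
      · left
        refine ⟨hi, ?_⟩
        have : (⟨i, h⟩ : Fin (k + 1)) = (⟨i, hi⟩ : Fin k).castSucc := rfl
        rwa [this, Fin.snoc_castSucc] at ha
      · right
        have : (⟨i, h⟩ : Fin (i + 1)) = Fin.last i := rfl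
        rw [this, Fin.snoc_last] at ha
        exact ⟨a, ha, rfl, rfl⟩
    · rintro (⟨hi, ha⟩ | ⟨b, hb, rfl, rfl⟩)
      · refine ⟨hi.trans (Nat.lt_succ_self k), ?_⟩
        have : (⟨i, hi.trans (Nat.lt_succ_self k)⟩ : Fin (k + 1)) = (⟨i, hi⟩ : Fin k).castSucc :=
          rfl
        rwa [this, Fin.snoc_castSucc]
      · refine ⟨Nat.lt_succ_self k, ?_⟩
        have : (⟨k, Nat.lt_succ_self k⟩ : Fin (k + 1)) = Fin.last k := rfl
        rwa [this, Fin.snoc_last]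

/-- The root of a tree. -/
def root (T : OrderedTree) : T.verts := ⟨[], T.nil_mem_verts⟩

/-- The vertices of `graft T B` are those of `T` and those of `B`. -/
def vertsGraftEquiv (T B : OrderedTree) : T.verts ⊕ B.verts ≃ (graft T B).verts :=
  Equiv.ofBijective
    (Sum.elim
      (fun v => ⟨v, by rw [verts_graft]; exact Finset.mem_union_left _ v.2⟩)
      (fun w => ⟨T.arity :: w, by
        rw [verts_graft]; exact Finset.mem_union_right _ (Finset.mem_image_of_mem _ w.2)⟩)) <| by
    constructor
    · rintro (⟨v, hv⟩ | ⟨v, hv⟩) (⟨w, hw⟩ | ⟨w, hw⟩) h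
      · simpa using h
      · simp only [Sum.elim_inl, Sum.elim_inr, Subtype.mk.injEq] at h
        exact absurd (lt_arity (h ▸ hv)) (lt_irrefl _)
      · simp only [Sum.elim_inl, Sum.elim_inr, Subtype.mk.injEq] at h
        exact absurd (lt_arity (h ▸ hw)) (lt_irrefl _)
      · simpa using h
    · rintro ⟨v, hv⟩
      have hv' := hv
      rw [verts_graft, Finset.mem_union, Finset.mem_image] at hv'
      rcases hv' with h | ⟨w, hw, rfl⟩
      · exact ⟨Sum.inl ⟨v, h⟩, rfl⟩
      · exact ⟨Sum.inr ⟨w, hw⟩, rfl⟩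

theorem addressGraph_adj_cons (k : ℕ) (a b : List ℕ) :
    addressGraph.Adj (k :: a) (k :: b) ↔ addressGraph.Adj a b := by
  simp [addressGraph]

theorem addressGraph_adj_cons_right {T : OrderedTree} {v : List ℕ} (hv : v ∈ T.verts)
    (w : List ℕ) : addressGraph.Adj v (T.arity :: w) ↔ v = [] ∧ w = [] := by
  rcases v with _ | ⟨j, v⟩
  · simp [addressGraph]
  · have := (lt_arity hv).ne
    simp [addressGraph, this, this.symm]

/-- Grafting joins the two trees by an edge between their roots. -/
def graftIso (T B : OrderedTree) : T.graph.join B.graph T.root B.root ≃g (graft T B).graph where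
  toEquiv := vertsGraftEquiv T B
  map_rel_iff' := by
    rintro (v | v) (w | w)
    · rw [SimpleGraph.join_adj_inl_inl]
      rfl
    · rw [SimpleGraph.join_adj_inl_inr]
      exact (addressGraph_adj_cons_right v.2 w).trans (by simp [root, Subtype.ext_iff])
    · rw [SimpleGraph.join_adj_inr_inl]
      exact (addressGraph.adj_comm _ _).trans
        ((addressGraph_adj_cons_right w.2 v).trans (by simp [root, Subtype.ext_iff]))
    · rw [SimpleGraph.join_adj_inr_inr]
      exact addressGraph_adj_cons _ _ _

theorem graftIso_root (T B : OrderedTree) :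
    graftIso T B (Sum.inl T.root) = (graft T B).root := rfl

/-- The number of matchings that leave the root uncovered. -/
def rootFreeZ (T : OrderedTree) : ℕ := (T.graph.matchingsAvoiding T.root).ncard

/-- The sum of the distances from the root. -/
def rootDist (T : OrderedTree) : ℕ := ∑ v, T.graph.dist T.root v

theorem verts_leaf : leaf.verts = {[]} := by
  simp [leaf, verts]

theorem subsingleton_verts_leaf : Subsingleton leaf.verts := by
  rw [verts_leaf]
  infer_instance

theorem connected_graph (T : OrderedTree) : T.graph.Connected := by
  induction T using graft_induction with
  | h0 =>
    have := subsingleton_verts_leaf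
    have : Nonempty leaf.verts := ⟨leaf.root⟩
    exact ⟨.of_subsingleton⟩
  | h1 T B hT hB =>
    exact (graftIso T B).connected_iff.1 (SimpleGraph.connected_join hT hB _ _)

theorem order_eq_card (T : OrderedTree) : T.order = Fintype.card T.verts := by
  rw [order, Fintype.card_coe]

theorem order_leaf : leaf.order = 1 := by
  rw [order, verts_leaf, Finset.card_singleton]

theorem order_graft (T B : OrderedTree) : (graft T B).order = T.order + B.order := by
  rw [order_eq_card, ← Fintype.card_congr (vertsGraftEquiv T B), Fintype.card_sum,
    order_eq_card, order_eq_card]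

theorem Z_graft (T B : OrderedTree) :
    (graft T B).Z = T.Z * B.Z + T.rootFreeZ * B.rootFreeZ := by
  rw [Z, ← (graftIso T B).hosoyaIndex_eq, SimpleGraph.hosoyaIndex_join]
  rfl

theorem rootFreeZ_graft (T B : OrderedTree) :
    (graft T B).rootFreeZ = T.rootFreeZ * B.Z := by
  rw [rootFreeZ, ← graftIso_root, ← (graftIso T B).ncard_matchingsAvoiding_eq,
    SimpleGraph.ncard_matchingsAvoiding_join]
  rfl

theorem rootDist_graft (T B : OrderedTree) :
    (graft T B).rootDist = T.rootDist + B.rootDist + B.order := by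
  rw [rootDist, ← graftIso_root, ← (graftIso T B).toEquiv.sum_comp, Fintype.sum_sum_type]
  have h : ∀ x, (graft T B).graph.dist (graftIso T B (Sum.inl T.root))
      ((graftIso T B).toEquiv x) = _ := fun x => (graftIso T B).dist_eq (Sum.inl T.root) x
  simp only [h, SimpleGraph.dist_join_inl_inl T.connected_graph B.connected_graph,
    SimpleGraph.dist_join_inl_inr T.connected_graph B.connected_graph, SimpleGraph.dist_self,
    Finset.sum_add_distrib, Finset.sum_const, rootDist, order_eq_card, Finset.card_univ]
  simp
  ring

theorem W_graft (T B : OrderedTree) : (graft T B).W = T.W + B.W +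
    (T.order * B.rootDist + T.order * B.order + B.order * T.rootDist) := by
  rw [W, ← (graftIso T B).wienerIndex_eq,
    SimpleGraph.wienerIndex_join T.connected_graph B.connected_graph, order_eq_card, order_eq_card]
  rfl

theorem matchings_graph_leaf : leaf.graph.matchings = {∅} := by
  have := subsingleton_verts_leaf
  have h : leaf.graph.edgeSet = ∅ := by
    rw [Subsingleton.elim leaf.graph ⊥, SimpleGraph.edgeSet_bot]
  ext M
  simp only [SimpleGraph.matchings, h, Set.subset_empty_iff, Set.mem_ofPred_eq,
    Set.mem_singleton_iff]
  exact ⟨fun hM => hM.1, fun hM => ⟨hM, by simp [hM]⟩⟩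

theorem Z_leaf : leaf.Z = 1 := by
  change leaf.graph.matchings.ncard = 1
  rw [matchings_graph_leaf, Set.ncard_singleton]

theorem rootFreeZ_leaf : leaf.rootFreeZ = 1 := by
  rw [rootFreeZ, SimpleGraph.matchingsAvoiding, matchings_graph_leaf, Set.ncard_eq_one]
  exact ⟨∅, by ext M; simp +contextual⟩

theorem rootDist_leaf : leaf.rootDist = 0 := by
  have := subsingleton_verts_leaf
  exact Finset.sum_eq_zero fun v _ => by
    rw [Subsingleton.elim v leaf.root, SimpleGraph.dist_self]

theorem W_leaf : leaf.W = 0 := by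
  have := subsingleton_verts_leaf
  have h := SimpleGraph.sum_sum_dist_eq leaf.graph
  rw [Finset.sum_eq_zero fun v _ => Finset.sum_eq_zero fun w _ => by
    rw [Subsingleton.elim v w, SimpleGraph.dist_self]] at h
  rw [W]
  omega

/-- The bijection between plane trees and binary trees, with `graft` as the node constructor. -/
def ofBinary : BinaryTree Unit → OrderedTree
  | .nil => leaf
  | .node _ l r => graft (ofBinary l) (ofBinary r)

theorem ofBinary_bijective : Function.Bijective ofBinary := by
  constructor
  · intro t
    induction t with
    | nil =>
      rintro (_ | ⟨_, l, r⟩) h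
      · rfl
      · exact absurd h.symm (graft_ne_leaf _ _)
    | node _ l r ihl ihr =>
      rintro (_ | ⟨_, l', r'⟩) h
      · exact absurd h (graft_ne_leaf _ _)
      · obtain ⟨h1, h2⟩ := graft_injective h
        rw [ihl h1, ihr h2]
  · intro T
    induction T using graft_induction with
    | h0 => exact ⟨.nil, rfl⟩
    | h1 T B hT hB =>
      obtain ⟨l, rfl⟩ := hT
      obtain ⟨r, rfl⟩ := hB
      exact ⟨.node () l r, rfl⟩

theorem order_ofBinary (t : BinaryTree Unit) : (ofBinary t).order = t.numNodes + 1 := by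
  induction t with
  | nil => exact order_leaf
  | node _ l r ihl ihr =>
    rw [ofBinary, order_graft, ihl, ihr, BinaryTree.numNodes]
    ring

theorem card_treesOfOrder_succ (n : ℕ) : (treesOfOrder (n + 1)).card = catalan n := by
  rw [← BinaryTree.treesOfNumNodesEq_card_eq_catalan]
  symm
  refine Finset.card_bijective ofBinary ofBinary_bijective fun t => ?_
  simp [treesOfOrder, order_ofBinary]

end OrderedTree

/-! ### Terms of the generating functions -/

namespace OrderedTree

section term

variable {𝕜 : Type*} [CommSemiring 𝕜]

/-- The contribution of a tree to the generating function of the statistic `f`. -/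
def term (f : OrderedTree → ℕ) (x : 𝕜) (T : OrderedTree) : 𝕜 := f T * x ^ T.order

variable (x : 𝕜) (T B : OrderedTree)

theorem term_Z_graft : term Z x (graft T B) =
    term Z x T * term Z x B + term rootFreeZ x T * term rootFreeZ x B := by
  simp only [term, order_graft, Z_graft]
  push_cast
  ring

theorem term_rootFreeZ_graft : term rootFreeZ x (graft T B) =
    term rootFreeZ x T * term Z x B := by
  simp only [term, order_graft, rootFreeZ_graft]
  push_cast
  ring

theorem term_order_mul_Z_graft : term (order * Z) x (graft T B) =
    term (order * Z) x T * term Z x B + term Z x T * term (order * Z) x B +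
      (term (order * rootFreeZ) x T * term rootFreeZ x B +
        term rootFreeZ x T * term (order * rootFreeZ) x B) := by
  simp only [term, Pi.mul_apply, order_graft, Z_graft]
  push_cast
  ring

theorem term_order_mul_rootFreeZ_graft : term (order * rootFreeZ) x (graft T B) =
    term (order * rootFreeZ) x T * term Z x B + term rootFreeZ x T * term (order * Z) x B := by
  simp only [term, Pi.mul_apply, order_graft, rootFreeZ_graft]
  push_cast
  ring

theorem term_rootDist_mul_Z_graft : term (rootDist * Z) x (graft T B) =
    term (rootDist * Z) x T * term Z x B + term Z x T * term (rootDist * Z) x B +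
      (term (rootDist * rootFreeZ) x T * term rootFreeZ x B +
        term rootFreeZ x T * term (rootDist * rootFreeZ) x B) +
      (term Z x T * term (order * Z) x B +
        term rootFreeZ x T * term (order * rootFreeZ) x B) := by
  simp only [term, Pi.mul_apply, order_graft, Z_graft, rootDist_graft]
  push_cast
  ring

theorem term_rootDist_mul_rootFreeZ_graft : term (rootDist * rootFreeZ) x (graft T B) =
    term (rootDist * rootFreeZ) x T * term Z x B + term rootFreeZ x T * term (rootDist * Z) x B +
      term rootFreeZ x T * term (order * Z) x B := by
  simp only [term, Pi.mul_apply, order_graft, rootFreeZ_graft, rootDist_graft]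
  push_cast
  ring

theorem term_W_mul_Z_graft : term (W * Z) x (graft T B) =
    term (W * Z) x T * term Z x B + term Z x T * term (W * Z) x B +
      (term (W * rootFreeZ) x T * term rootFreeZ x B +
        term rootFreeZ x T * term (W * rootFreeZ) x B) +
      (term (order * Z) x T * term (rootDist * Z) x B +
        term (order * Z) x T * term (order * Z) x B +
        term (rootDist * Z) x T * term (order * Z) x B +
        (term (order * rootFreeZ) x T * term (rootDist * rootFreeZ) x B +
        term (order * rootFreeZ) x T * term (order * rootFreeZ) x B +
        term (rootDist * rootFreeZ) x T * term (order * rootFreeZ) x B)) := by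
  simp only [term, Pi.mul_apply, order_graft, Z_graft, W_graft]
  push_cast
  ring

theorem term_W_mul_rootFreeZ_graft : term (W * rootFreeZ) x (graft T B) =
    term (W * rootFreeZ) x T * term Z x B + term rootFreeZ x T * term (W * Z) x B +
      (term (order * rootFreeZ) x T * term (rootDist * Z) x B +
        term (order * rootFreeZ) x T * term (order * Z) x B +
        term (rootDist * rootFreeZ) x T * term (order * Z) x B) := by
  simp only [term, Pi.mul_apply, order_graft, rootFreeZ_graft, W_graft]
  push_cast
  ring

theorem term_leaf (f : OrderedTree → ℕ) : term f x leaf = f leaf * x := by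
  rw [term, order_leaf, pow_one]

end term

section finite

/-- The trees with fewer than `n` vertices. -/
def treesOfOrderLT (n : ℕ) : Finset OrderedTree := (finite_order_lt n).toFinset

theorem mem_treesOfOrderLT {n : ℕ} {T : OrderedTree} : T ∈ treesOfOrderLT n ↔ T.order < n := by
  simp [treesOfOrderLT]

theorem term_nonneg (f : OrderedTree → ℕ) {x : ℝ} (hx : 0 ≤ x) (T : OrderedTree) :
    0 ≤ term f x T := by
  unfold term; positivity

/-- The partial generating function over the trees with fewer than `n` vertices. -/
def partialSum (f : OrderedTree → ℕ) (x : ℝ) (n : ℕ) : ℝ := ∑ T ∈ treesOfOrderLT n, term f x T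

theorem partialSum_nonneg (f : OrderedTree → ℕ) {x : ℝ} (hx : 0 ≤ x) (n : ℕ) :
    0 ≤ partialSum f x n := Finset.sum_nonneg fun T _ => term_nonneg f hx T

theorem partialSum_zero (f : OrderedTree → ℕ) (x : ℝ) : partialSum f x 0 = 0 := by
  rw [partialSum, Finset.sum_eq_zero]
  intro T hT
  simp [mem_treesOfOrderLT] at hT

theorem partialSum_succ_le (f : OrderedTree → ℕ) {x : ℝ} (hx : 0 ≤ x) (n : ℕ) :
    partialSum f x (n + 1) ≤ f leaf * x +
      ∑ T ∈ treesOfOrderLT n, ∑ B ∈ treesOfOrderLT n, term f x (graft T B) := by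
  classical
  rw [← Finset.sum_product', ← term_leaf x f]
  have hinj : Set.InjOn (fun p : OrderedTree × OrderedTree => graft p.1 p.2)
      (treesOfOrderLT n ×ˢ treesOfOrderLT n : Finset _) := fun p _ p' _ h =>
    Prod.ext (graft_injective h).1 (graft_injective h).2
  rw [← Finset.sum_image (f := term f x) hinj, ← Finset.sum_insert]
  · refine Finset.sum_le_sum_of_subset_of_nonneg (fun T hT => ?_) fun T _ _ => term_nonneg f hx T
    rw [mem_treesOfOrderLT] at hT
    induction T using graft_induction with
    | h0 => exact Finset.mem_insert_self _ _
    | h1 T B =>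
      rw [order_graft] at hT
      have h1 := T.order_pos
      have h2 := B.order_pos
      refine Finset.mem_insert_of_mem (Finset.mem_image.2 ⟨(T, B), ?_, rfl⟩)
      simp only [Finset.mem_product, mem_treesOfOrderLT]
      omega
  · intro h
    obtain ⟨p, -, hp⟩ := Finset.mem_image.1 h
    exact graft_ne_leaf _ _ hp

theorem sum_le_of_partialSum_le {f : OrderedTree → ℕ} {x c : ℝ} (hx : 0 ≤ x)
    (h : ∀ n, partialSum f x n ≤ c) (u : Finset OrderedTree) : ∑ T ∈ u, term f x T ≤ c := by
  refine le_trans ?_ (h (u.sup order + 1))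
  refine Finset.sum_le_sum_of_subset_of_nonneg (fun T hT => ?_) fun T _ _ => term_nonneg f hx T
  rw [mem_treesOfOrderLT]
  exact Nat.lt_succ_of_le (Finset.le_sup (f := order) hT)

end finite

section infinite

/-- A generating function is the contribution of `leaf` plus a double sum over grafts. -/
theorem hasSum_graft {F : OrderedTree → ℂ} {a b : ℂ} (ha : HasSum F a)
    (hb : HasSum (fun p : OrderedTree × OrderedTree => F (graft p.1 p.2)) b) :
    a = F leaf + b := by
  have h : HasSum (F ∘ graftEquiv) (F leaf + b) := by
    have h1 : HasSum (fun o : Option (OrderedTree × OrderedTree) =>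
        if o = none then F leaf else 0) (F leaf) := hasSum_ite_eq none _
    have h2 : HasSum (fun o : Option (OrderedTree × OrderedTree) =>
        o.elim 0 fun p => F (graft p.1 p.2)) b := by
      refine ((Option.some_injective _).hasSum_iff ?_).1 hb
      rintro (_ | p) hp
      · rfl
      · exact absurd ⟨p, rfl⟩ hp
    refine (h1.add h2).congr_fun ?_
    rintro (_ | p)
    · simp only [if_true, Option.elim_none, add_zero]
      rfl
    · simp only [reduceCtorEq, if_false, Option.elim_some, zero_add]
      rfl
  exact ha.unique (graftEquiv.hasSum_iff.1 h)

theorem norm_term (f : OrderedTree → ℕ) (z : ℂ) (T : OrderedTree) :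
    ‖term f z T‖ = term f ‖z‖ T := by
  simp [term]

end infinite

end OrderedTree

/-! ### Closed forms of the generating functions -/

namespace OrderedTree

section solution

variable {𝕜 : Type*} [Field 𝕜]

/-- The polynomial `1 + s + s ^ 2`, the common denominator of the parametrization. -/
def quad (s : 𝕜) : 𝕜 := 1 + s + s ^ 2

/-- The polynomial whose zeros are the critical points of `zOf`; up to a power of `quad s` it is the
determinant of the linear systems solved by `linZ` and `linR`. -/
def crit (s : 𝕜) : 𝕜 := 1 - s - 3 * s ^ 2

/-- The variable `z` as a rational function of the uniformizing parameter `s`. -/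
def zOf (s : 𝕜) : 𝕜 := s / quad s ^ 2

/-- The generating function of `Z`, in terms of the parameter. -/
def solZ (s : 𝕜) : 𝕜 := (s + s ^ 2) / quad s

/-- The generating function of `rootFreeZ`, in terms of the parameter. -/
def solR (s : 𝕜) : 𝕜 := s / quad s

/-- The first component of the solution of `X = 2 A X + 2 B Y + u`, `Y = B X + A Y + v`, where
`A = solZ s` and `B = solR s`. -/
def linZ (s u v : 𝕜) : 𝕜 := quad s / crit s * (u + 2 * s * v)

/-- The second component of the solution of `X = 2 A X + 2 B Y + u`, `Y = B X + A Y + v`, where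
`A = solZ s` and `B = solR s`. -/
def linR (s u v : 𝕜) : 𝕜 := quad s / crit s * (s * u + (1 - s - s ^ 2) * v)

/-- The generating function of `order * Z`, in terms of the parameter. -/
def solNZ (s : 𝕜) : 𝕜 := linZ s (zOf s) (zOf s)

/-- The generating function of `order * rootFreeZ`, in terms of the parameter. -/
def solNR (s : 𝕜) : 𝕜 := linR s (zOf s) (zOf s)

/-- The generating function of `rootDist * Z`, in terms of the parameter. -/
def solDZ (s : 𝕜) : 𝕜 := linZ s (solZ s * solNZ s + solR s * solNR s) (solR s * solNZ s)

/-- The generating function of `rootDist * rootFreeZ`, in terms of the parameter. -/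
def solDR (s : 𝕜) : 𝕜 := linR s (solZ s * solNZ s + solR s * solNR s) (solR s * solNZ s)

/-- The inhomogeneity of the equation for the generating function of `W * Z`. -/
def inhomWZ (s : 𝕜) : 𝕜 :=
  solNZ s * solDZ s + solNZ s * solNZ s + solDZ s * solNZ s +
    (solNR s * solDR s + solNR s * solNR s + solDR s * solNR s)

/-- The inhomogeneity of the equation for the generating function of `W * rootFreeZ`. -/
def inhomWR (s : 𝕜) : 𝕜 :=
  solNR s * solDZ s + solNR s * solNZ s + solDR s * solNZ s

/-- The generating function of `W * Z`, in terms of the parameter. -/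
def solWZ (s : 𝕜) : 𝕜 := linZ s (inhomWZ s) (inhomWR s)

/-- The generating function of `W * rootFreeZ`, in terms of the parameter. -/
def solWR (s : 𝕜) : 𝕜 := linR s (inhomWZ s) (inhomWR s)

variable {s : 𝕜}

theorem solZ_eq (hq : quad s ≠ 0) :
    solZ s = zOf s + (solZ s * solZ s + solR s * solR s) := by
  unfold solZ solR zOf
  field_simp
  unfold quad
  ring

theorem solR_eq (hq : quad s ≠ 0) : solR s = zOf s + solR s * solZ s := by
  unfold solZ solR zOf
  field_simp
  unfold quad
  ring

theorem linZ_eq (hq : quad s ≠ 0) (hc : crit s ≠ 0) (u v : 𝕜) :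
    linZ s u v = linZ s u v * solZ s + solZ s * linZ s u v +
      (linR s u v * solR s + solR s * linR s u v) + u := by
  unfold linZ linR solZ solR
  field_simp
  unfold quad crit
  ring

theorem linR_eq (hq : quad s ≠ 0) (hc : crit s ≠ 0) (u v : 𝕜) :
    linR s u v = linR s u v * solZ s + solR s * linZ s u v + v := by
  unfold linZ linR solZ solR
  field_simp
  unfold quad crit
  ring

/-- The linear system has no other solution. -/
theorem eq_lin (hq : quad s ≠ 0) (hc : crit s ≠ 0) {u v X Y : 𝕜}
    (hX : X = X * solZ s + solZ s * X + (Y * solR s + solR s * Y) + u)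
    (hY : Y = Y * solZ s + solR s * X + v) : X = linZ s u v ∧ Y = linR s u v := by
  have hu : u = X - (X * solZ s + solZ s * X + (Y * solR s + solR s * Y)) := by
    linear_combination -hX
  have hv : v = Y - (Y * solZ s + solR s * X) := by linear_combination -hY
  rw [hu, hv]
  unfold linZ linR solZ solR
  constructor <;> field_simp <;> unfold quad crit <;> ring

end solution

section realBound

variable {s : ℝ}

/-- For a nonnegative real parameter below the critical one, the closed forms dominate all partial
generating functions. -/
theorem partialSum_le (hs : 0 ≤ s) (hc : 0 < crit s) (n : ℕ) :
    (partialSum Z (zOf s) n ≤ solZ s ∧ partialSum rootFreeZ (zOf s) n ≤ solR s) ∧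
    (partialSum (order * Z) (zOf s) n ≤ solNZ s ∧
      partialSum (order * rootFreeZ) (zOf s) n ≤ solNR s) ∧
    (partialSum (rootDist * Z) (zOf s) n ≤ solDZ s ∧
      partialSum (rootDist * rootFreeZ) (zOf s) n ≤ solDR s) ∧
    (partialSum (W * Z) (zOf s) n ≤ solWZ s ∧ partialSum (W * rootFreeZ) (zOf s) n ≤ solWR s) := by
  have hq : 0 < quad s := by unfold quad; positivity
  have hx : 0 ≤ zOf s := by unfold zOf; positivity
  have hlin : ∀ u v : ℝ, 0 ≤ u → 0 ≤ v → 0 ≤ linZ s u v ∧ 0 ≤ linR s u v := by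
    intro u v hu hv
    have h1 : 0 ≤ 1 - s - s ^ 2 := by unfold crit at hc; nlinarith [sq_nonneg s]
    unfold linZ linR
    constructor <;> positivity
  have hZ : 0 ≤ solZ s := by unfold solZ; positivity
  have hR : 0 ≤ solR s := by unfold solR; positivity
  obtain ⟨hNZ, hNR⟩ : 0 ≤ solNZ s ∧ 0 ≤ solNR s := hlin _ _ hx hx
  obtain ⟨hDZ, hDR⟩ : 0 ≤ solDZ s ∧ 0 ≤ solDR s := hlin _ _ (by positivity) (by positivity)
  obtain ⟨hWZ, hWR⟩ : 0 ≤ solWZ s ∧ 0 ≤ solWR s :=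
    hlin _ _ (by unfold inhomWZ; positivity) (by unfold inhomWR; positivity)
  induction n with
  | zero => simp only [partialSum_zero]; tauto
  | succ n ih =>
    obtain ⟨⟨iZ, iR⟩, ⟨iNZ, iNR⟩, ⟨iDZ, iDR⟩, iWZ, iWR⟩ := ih
    have nn := fun f => partialSum_nonneg f hx n
    have e : ∀ f g, ∑ T ∈ treesOfOrderLT n, ∑ B ∈ treesOfOrderLT n,
        term f (zOf s) T * term g (zOf s) B = partialSum f (zOf s) n * partialSum g (zOf s) n :=
      fun f g => (Finset.sum_mul_sum ..).symm
    refine ⟨⟨?_, ?_⟩, ⟨?_, ?_⟩, ⟨?_, ?_⟩, ?_, ?_⟩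
    · refine (partialSum_succ_le _ hx n).trans ?_
      simp only [term_Z_graft, Finset.sum_add_distrib, e, Z_leaf]
      rw [solZ_eq hq.ne', Nat.cast_one, one_mul]
      gcongr <;> apply nn
    · refine (partialSum_succ_le _ hx n).trans ?_
      simp only [term_rootFreeZ_graft, e, rootFreeZ_leaf]
      rw [solR_eq hq.ne', Nat.cast_one, one_mul]
      gcongr
      apply nn
    · refine (partialSum_succ_le _ hx n).trans ?_
      simp only [term_order_mul_Z_graft, Finset.sum_add_distrib, e, Pi.mul_apply, Z_leaf,
        order_leaf]
      rw [solNZ, linZ_eq hq.ne' hc.ne', ← solNZ, ← solNR, mul_one, Nat.cast_one, one_mul, add_comm]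
      gcongr <;> apply nn
    · refine (partialSum_succ_le _ hx n).trans ?_
      simp only [term_order_mul_rootFreeZ_graft, Finset.sum_add_distrib, e, Pi.mul_apply,
        rootFreeZ_leaf, order_leaf]
      rw [solNR, linR_eq hq.ne' hc.ne', ← solNZ, ← solNR, mul_one, Nat.cast_one, one_mul, add_comm]
      gcongr <;> apply nn
    · refine (partialSum_succ_le _ hx n).trans ?_
      simp only [term_rootDist_mul_Z_graft, Finset.sum_add_distrib, e, Pi.mul_apply, Z_leaf,
        rootDist_leaf]
      rw [solDZ, linZ_eq hq.ne' hc.ne', ← solDZ, ← solDR, zero_mul, Nat.cast_zero, zero_mul,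
        zero_add]
      gcongr <;> apply nn
    · refine (partialSum_succ_le _ hx n).trans ?_
      simp only [term_rootDist_mul_rootFreeZ_graft, Finset.sum_add_distrib, e, Pi.mul_apply,
        rootFreeZ_leaf, rootDist_leaf]
      rw [solDR, linR_eq hq.ne' hc.ne', ← solDZ, ← solDR, zero_mul, Nat.cast_zero, zero_mul,
        zero_add]
      gcongr <;> apply nn
    · refine (partialSum_succ_le _ hx n).trans ?_
      simp only [term_W_mul_Z_graft, Finset.sum_add_distrib, e, Pi.mul_apply, Z_leaf, W_leaf]
      rw [solWZ, linZ_eq hq.ne' hc.ne', ← solWZ, ← solWR, zero_mul, Nat.cast_zero, zero_mul,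
        zero_add, inhomWZ]
      gcongr <;> apply nn
    · refine (partialSum_succ_le _ hx n).trans ?_
      simp only [term_W_mul_rootFreeZ_graft, Finset.sum_add_distrib, e, Pi.mul_apply,
        rootFreeZ_leaf, W_leaf]
      rw [solWR, linR_eq hq.ne' hc.ne', ← solWZ, ← solWR, zero_mul, Nat.cast_zero, zero_mul,
        zero_add, inhomWR]
      gcongr <;> apply nn

end realBound

/-- The critical parameter, the positive root of `crit`. -/
def s₀ : ℝ := (√13 - 1) / 6

theorem s₀_bounds : 2 / 5 < s₀ ∧ s₀ < 1 / 2 := by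
  have h1 : (3.6 : ℝ) < √13 := Real.lt_sqrt_of_sq_lt (by norm_num)
  have h2 : √13 < 3.7 := (Real.sqrt_lt' (by norm_num)).2 (by norm_num)
  constructor <;> unfold s₀ <;> linarith

theorem s₀_sq : 3 * s₀ ^ 2 = 1 - s₀ := by
  have := Real.sq_sqrt (show (0 : ℝ) ≤ 13 by norm_num)
  unfold s₀
  linear_combination this / 12

theorem zOf_s₀ : zOf s₀ = z₀ := by
  have h := Real.sq_sqrt (show (0 : ℝ) ≤ 13 by norm_num)
  have hq : quad s₀ ≠ 0 := by
    have := s₀_bounds.1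
    unfold quad; positivity
  rw [zOf, div_eq_iff (pow_ne_zero _ hq), quad]
  have h2 : s₀ ^ 2 = (1 - s₀) / 3 := by linear_combination s₀_sq / 3
  rw [h2, s₀, z₀]
  have h3 : √13 ^ 3 = 13 * √13 := by rw [pow_succ, h]
  ring_nf
  rw [h3, h]
  ring

theorem crit_pos {s : ℝ} (hs : 0 ≤ s) (h : s < s₀) : 0 < crit s := by
  have := s₀_sq
  unfold crit
  nlinarith

/-- Every modulus below `z₀` is the image of a parameter in `[0, s₀)`. -/
theorem exists_zOf_eq {x : ℝ} (hx : 0 ≤ x) (hx' : x < z₀) : ∃ s, 0 ≤ s ∧ s < s₀ ∧ zOf s = x := by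
  have hs0 : (0 : ℝ) ≤ s₀ := by linarith [s₀_bounds.1]
  have hcont : ContinuousOn (zOf : ℝ → ℝ) (Set.Icc 0 s₀) := by
    unfold zOf quad
    refine continuousOn_id.div (by fun_prop) fun s hs => ?_
    have := hs.1
    positivity
  have := intermediate_value_Icc hs0 hcont
  rw [zOf_s₀] at this
  obtain ⟨s, hs, h⟩ := this ⟨by simpa [zOf] using hx, hx'.le⟩
  refine ⟨s, hs.1, lt_of_le_of_ne hs.2 ?_, h⟩
  rintro rfl
  rw [zOf_s₀] at h
  exact hx'.ne h.symm

/-- Inside the disc of radius `z₀` the generating function of `W * Z` is the rational function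
`solWZ` of a parameter `s` with `zOf s = z`. -/
theorem hasSum_term_W_mul_Z {z : ℂ} (hz : ‖z‖ < z₀) :
    ∃ s : ℂ, ‖s‖ ≤ s₀ ∧ zOf s = z ∧ HasSum (term (W * Z) z) (solWZ s) := by
  obtain ⟨t, ht, ht', htz⟩ := exists_zOf_eq (norm_nonneg z) hz
  have hc := crit_pos ht ht'
  have hqt : 0 < quad t := by unfold quad; positivity
  have bound := partialSum_le ht hc
  rw [htz] at bound
  have hnn := fun f => term_nonneg f (norm_nonneg z)
  have hsum : ∀ {f : OrderedTree → ℕ} {c : ℝ}, (∀ n, partialSum f ‖z‖ n ≤ c) →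
      Summable (fun T => ‖term f z T‖) ∧ ‖∑' T, term f z T‖ ≤ c := by
    intro f c h
    have h' := sum_le_of_partialSum_le (norm_nonneg z) h
    have hS : Summable (fun T => ‖term f z T‖) := by
      simp only [norm_term]
      exact summable_of_sum_le (hnn f) h'
    refine ⟨hS, (norm_tsum_le_tsum_norm hS).trans ?_⟩
    simp only [norm_term]
    exact Real.tsum_le_of_sum_le (hnn f) h'
  obtain ⟨hZ, bZ⟩ := hsum fun n => (bound n).1.1
  obtain ⟨hR, bR⟩ := hsum fun n => (bound n).1.2
  have hNZ := (hsum fun n => (bound n).2.1.1).1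
  have hNR := (hsum fun n => (bound n).2.1.2).1
  have hDZ := (hsum fun n => (bound n).2.2.1.1).1
  have hDR := (hsum fun n => (bound n).2.2.1.2).1
  have hWZ := (hsum fun n => (bound n).2.2.2.1).1
  have hWR := (hsum fun n => (bound n).2.2.2.2).1
  have mul : ∀ {f g : OrderedTree → ℕ}, Summable (fun T => ‖term f z T‖) →
      Summable (fun T => ‖term g z T‖) →
      HasSum (fun p : OrderedTree × OrderedTree => term f z p.1 * term g z p.2)
        ((∑' T, term f z T) * ∑' T, term g z T) := fun hf hg =>
    hf.of_norm.hasSum.mul hg.of_norm.hasSum (summable_mul_of_summable_norm hf hg)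
  have eZ := hasSum_graft hZ.of_norm.hasSum
    (((mul hZ hZ).add (mul hR hR)).congr_fun fun p => term_Z_graft z p.1 p.2)
  have eR := hasSum_graft hR.of_norm.hasSum
    ((mul hR hZ).congr_fun fun p => term_rootFreeZ_graft z p.1 p.2)
  have eNZ := hasSum_graft hNZ.of_norm.hasSum
    ((((mul hNZ hZ).add (mul hZ hNZ)).add ((mul hNR hR).add (mul hR hNR))).congr_fun
      fun p => term_order_mul_Z_graft z p.1 p.2)
  have eNR := hasSum_graft hNR.of_norm.hasSum
    (((mul hNR hZ).add (mul hR hNZ)).congr_fun fun p => term_order_mul_rootFreeZ_graft z p.1 p.2)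
  have eDZ := hasSum_graft hDZ.of_norm.hasSum
    (((((mul hDZ hZ).add (mul hZ hDZ)).add ((mul hDR hR).add (mul hR hDR))).add
      ((mul hZ hNZ).add (mul hR hNR))).congr_fun fun p => term_rootDist_mul_Z_graft z p.1 p.2)
  have eDR := hasSum_graft hDR.of_norm.hasSum
    ((((mul hDR hZ).add (mul hR hDZ)).add (mul hR hNZ)).congr_fun
      fun p => term_rootDist_mul_rootFreeZ_graft z p.1 p.2)
  have eWZ := hasSum_graft hWZ.of_norm.hasSum
    (((((mul hWZ hZ).add (mul hZ hWZ)).add ((mul hWR hR).add (mul hR hWR))).add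
      ((((mul hNZ hDZ).add (mul hNZ hNZ)).add (mul hDZ hNZ)).add
        (((mul hNR hDR).add (mul hNR hNR)).add (mul hDR hNR)))).congr_fun
      fun p => term_W_mul_Z_graft z p.1 p.2)
  have eWR := hasSum_graft hWR.of_norm.hasSum
    ((((mul hWR hZ).add (mul hR hWZ)).add
      (((mul hNR hDZ).add (mul hNR hNZ)).add (mul hDR hNZ))).congr_fun
      fun p => term_W_mul_rootFreeZ_graft z p.1 p.2)
  have key := hWZ.of_norm.hasSum
  simp only [term_leaf, Pi.mul_apply, Z_leaf, rootFreeZ_leaf, order_leaf, rootDist_leaf, W_leaf,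
    mul_one, one_mul, zero_mul, Nat.cast_one, Nat.cast_zero, zero_add]
    at eZ eR eNZ eNR eDZ eDR eWZ eWR
  generalize ∑' T, term Z z T = A at *
  generalize ∑' T, term rootFreeZ z T = B at *
  generalize ∑' T, term (order * Z) z T = NA at *
  generalize ∑' T, term (order * rootFreeZ) z T = NB at *
  generalize ∑' T, term (rootDist * Z) z T = DA at *
  generalize ∑' T, term (rootDist * rootFreeZ) z T = DB at *
  generalize ∑' T, term (W * Z) z T = WA at *
  generalize ∑' T, term (W * rootFreeZ) z T = WB at *
  have hA1 : 1 - solZ t = 1 / quad t := by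
    unfold solZ
    rw [eq_div_iff hqt.ne', sub_mul, div_mul_cancel₀ _ hqt.ne', quad]
    ring
  have hA : 1 / quad t ≤ ‖1 - A‖ := by
    rw [← hA1]
    have := norm_sub_norm_le 1 A
    rw [norm_one] at this
    linarith
  have hA0 : 0 < ‖1 - A‖ := lt_of_lt_of_le (by positivity) hA
  have hA' : 1 - A ≠ 0 := norm_pos_iff.1 hA0
  -- The quotient `B / (1 - A)` uniformizes the algebraic curve of the pair `(A, B)`.
  obtain ⟨s, hs⟩ : ∃ s, s = B / (1 - A) := ⟨_, rfl⟩
  have hB : B = s * (1 - A) := by rw [hs, div_mul_cancel₀ _ hA']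
  have hst : ‖s‖ ≤ t := by
    rw [hs, norm_div, div_le_iff₀ hA0]
    refine bR.trans ?_
    rw [solR, div_eq_mul_one_div]
    gcongr
  have hz' : z = s * (1 - A) ^ 2 := by linear_combination eR.symm + (1 - A) * hB
  have h1 : (1 - A) * quad s = 1 := by
    apply mul_left_cancel₀ hA'
    unfold quad
    rw [hB] at eZ
    linear_combination -eZ - hz'
  have hq : quad s ≠ 0 := right_ne_zero_of_mul_eq_one h1
  have hAq : 1 - A = 1 / quad s := by rw [eq_div_iff hq, h1]
  have hzs : z = zOf s := by rw [hz', hAq, zOf]; field_simp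
  have hAs : A = solZ s := by
    have : A = 1 - 1 / quad s := by rw [← hAq]; ring
    rw [this, solZ, eq_div_iff hq, sub_mul, div_mul_cancel₀ _ hq, quad]
    ring
  have hBs : B = solR s := by rw [hB, hAq, solR]; ring
  -- Since `‖s‖ ≤ t < s₀`, the triangle inequality keeps `s + 3 s²` away from `1`.
  have hcs : crit s ≠ 0 := by
    intro h
    have h2 : (1 : ℂ) = s + 3 * s ^ 2 := by unfold crit at h; linear_combination h
    have h3 : (1 : ℝ) ≤ t + 3 * t ^ 2 := by
      calc (1 : ℝ) = ‖s + 3 * s ^ 2‖ := by rw [← h2, norm_one]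
        _ ≤ ‖s‖ + 3 * ‖s‖ ^ 2 := (norm_add_le _ _).trans (by simp)
        _ ≤ t + 3 * t ^ 2 := by gcongr
    unfold crit at hc
    linarith
  subst hAs hBs hzs
  obtain ⟨rfl, rfl⟩ : NA = solNZ s ∧ NB = solNR s :=
    eq_lin hq hcs (by linear_combination eNZ) (by linear_combination eNR)
  obtain ⟨rfl, rfl⟩ : DA = solDZ s ∧ DB = solDR s :=
    eq_lin hq hcs (by linear_combination eDZ) (by linear_combination eDR)
  obtain ⟨rfl, rfl⟩ : WA = solWZ s ∧ WB = solWR s :=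
    eq_lin hq hcs (by rw [inhomWZ]; exact eWZ) (by rw [inhomWR]; exact eWR)
  exact ⟨s, hst.trans ht'.le, rfl, key⟩

end OrderedTree

/-! ### The inverse of the parametrization on a slit disc -/

/-- An analytic function that is injective with nonvanishing derivative on a compact set has an
analytic inverse on a neighbourhood of the image. -/
theorem exists_differentiableOn_inverse {f : ℂ → ℂ} {D L : Set ℂ} (hD : IsOpen D)
    (hf : DifferentiableOn ℂ f D) (hL : IsCompact L) (hLD : L ⊆ D) (hinj : Set.InjOn f L)
    (hder : ∀ s ∈ L, deriv f s ≠ 0) :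
    ∃ (V : Set ℂ) (p : ℂ → ℂ), IsOpen V ∧ f '' L ⊆ V ∧ DifferentiableOn ℂ p V ∧
      (∀ u ∈ V, p u ∈ D ∧ f (p u) = u) ∧ ∀ s ∈ L, p (f s) = s := by
  have hstrict : ∀ s ∈ D, HasStrictDerivAt f (deriv f s) s := fun s hs =>
    (hf.analyticAt (hD.mem_nhds hs)).hasStrictDerivAt
  have hdc : ContinuousOn (deriv f) D := ((hf.analyticOnNhd hD).deriv).continuousOn
  obtain ⟨U₀, hU₀, hLU₀, hinjU₀⟩ := hinj.exists_isOpen_superset hL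
    (fun s hs => (hf.continuousOn.continuousAt (hD.mem_nhds (hLD hs)))) (fun s hs => by
      have h := ((hstrict s (hLD hs)).hasStrictFDerivAt_equiv (hder s hs)).eventually_left_inverse
      exact ⟨_, h, fun x hx y hy hxy => by
        rw [Set.mem_ofPred_eq] at hx hy
        rw [← hx, ← hy, hxy]⟩)
  have hU₁ : IsOpen (D ∩ {s | deriv f s ≠ 0}) :=
    hdc.isOpen_inter_preimage hD isOpen_ne
  set U := U₀ ∩ (D ∩ {s | deriv f s ≠ 0}) with hU
  have hUo : IsOpen U := hU₀.inter hU₁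
  have hinjU : Set.InjOn f U := hinjU₀.mono Set.inter_subset_left
  have hleft : ∀ s ∈ U, Function.invFunOn f U (f s) = s := fun s hs =>
    hinjU.leftInvOn_invFunOn hs
  have hLU : L ⊆ U := fun s hs => ⟨hLU₀ hs, hLD hs, hder s hs⟩
  refine ⟨f '' U, Function.invFunOn f U, ?_, Set.image_mono hLU, ?_, ?_,
    fun s hs => hleft s (hLU hs)⟩
  · rw [isOpen_iff_mem_nhds]
    rintro _ ⟨s, hs, rfl⟩
    rw [← (hstrict s hs.2.1).map_nhds_eq hs.2.2]
    exact image_mem_map (hUo.mem_nhds hs)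
  · rintro _ ⟨s, hs, rfl⟩
    exact ((hstrict s hs.2.1).to_local_left_inverse hs.2.2
      (eventually_of_mem (hUo.mem_nhds hs) hleft)).hasDerivAt.differentiableAt.differentiableWithinAt
  · rintro _ ⟨s, hs, rfl⟩
    rw [hleft s hs]
    exact ⟨hs.2.1, rfl⟩

/-- The principal branch of the complex square root. -/
def sqrtC (w : ℂ) : ℂ := w ^ (((2 : ℕ) : ℂ)⁻¹)

theorem sqrtC_sq (w : ℂ) : sqrtC w ^ 2 = w := Complex.cpow_nat_inv_pow w two_ne_zero

theorem sqrtC_re_nonneg (w : ℂ) : 0 ≤ (sqrtC w).re := by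
  by_cases hw : w = 0
  · simp [sqrtC, hw]
  · rw [sqrtC, Complex.cpow_def_of_ne_zero hw, Complex.exp_re]
    refine mul_nonneg (Real.exp_pos _).le (Real.cos_nonneg_of_mem_Icc ?_)
    have h1 := Complex.neg_pi_lt_arg w
    have h2 := Complex.arg_le_pi w
    have h3 : (Complex.log w * ((2 : ℕ) : ℂ)⁻¹).im = w.arg / 2 := by
      have : (((2 : ℕ) : ℂ)⁻¹) = ((2⁻¹ : ℝ) : ℂ) := by push_cast; rfl
      rw [this, Complex.im_mul_ofReal, Complex.log_im, div_eq_mul_inv]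
    rw [h3]
    constructor <;> linarith

theorem differentiableAt_sqrtC {w : ℂ} (hw : w ∈ Complex.slitPlane) :
    DifferentiableAt ℂ sqrtC w :=
  differentiableAt_id.cpow_const hw

theorem tendsto_sqrtC_zero : Tendsto sqrtC (𝓝 0) (𝓝 0) := by
  have : ContinuousAt sqrtC 0 :=
    Complex.continuousAt_cpow_const_of_re_pos (by simp) (by norm_num)
  simpa [ContinuousAt, sqrtC] using this

namespace OrderedTree

/-- The quadratic cofactor of the double zero of `z₀ - zOf s` at `s₀`. -/
def cofactor (s : ℂ) : ℂ := s ^ 2 + (2 + 2 * s₀) * s + (3 + 4 * s₀ + 3 * s₀ ^ 2)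

/-- An analytic square root of `1 - zOf s / z₀`. -/
def uOf (s : ℂ) : ℂ := (s₀ - s) * sqrtC (cofactor s) / quad s

/-- The critical equation `crit s₀ = 0`, multiplied by `quad s₀`. -/
theorem s₀_poly : 3 * s₀ ^ 2 + 4 * s₀ ^ 3 + 3 * s₀ ^ 4 = 1 := by
  linear_combination (1 + s₀ + s₀ ^ 2) * s₀_sq

theorem z₀_pos : 0 < z₀ := by
  have h1 := s₀_bounds.1
  rw [← zOf_s₀, zOf, quad]
  positivity

theorem s₀C_sq : 3 * (s₀ : ℂ) ^ 2 = 1 - s₀ := by exact_mod_cast s₀_sq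

theorem zOf_s₀C : zOf (s₀ : ℂ) = z₀ := by
  rw [← zOf_s₀]
  simp [zOf, quad]

theorem quad_ne_zero {s : ℂ} (hs : ‖s‖ < 1 / 2) : quad s ≠ 0 := by
  intro h
  have h1 : (1 : ℂ) = -(s + s ^ 2) := by unfold quad at h; linear_combination h
  have h2 : (1 : ℝ) ≤ ‖s‖ + ‖s‖ ^ 2 := by
    calc (1 : ℝ) = ‖-(s + s ^ 2)‖ := by rw [← h1, norm_one]
      _ ≤ ‖s‖ + ‖s‖ ^ 2 := by rw [norm_neg, ← norm_pow]; exact norm_add_le _ _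
  nlinarith [norm_nonneg s]

theorem crit_eq (s : ℂ) : crit s = 3 * (s₀ - s) * (s + s₀ + 1 / 3) := by
  unfold crit
  linear_combination -s₀C_sq

theorem add_s₀_ne_zero {s : ℂ} (hs : ‖s‖ < 1 / 2) : s + s₀ + 1 / 3 ≠ 0 := by
  intro h
  have h1 := Complex.abs_re_le_norm s
  have h2 := congrArg Complex.re h
  have h3 := (abs_le.1 (h1.trans hs.le)).1
  have h4 := s₀_bounds.1
  have h5 : ((1 : ℂ) / 3).re = 1 / 3 := by norm_num
  simp only [Complex.add_re, Complex.ofReal_re, Complex.zero_re, h5] at h2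
  linarith

theorem crit_ne_zero {s : ℂ} (hs : ‖s‖ < 1 / 2) (h : s ≠ s₀) : crit s ≠ 0 := by
  rw [crit_eq]
  exact mul_ne_zero (mul_ne_zero three_ne_zero (sub_ne_zero.2 h.symm)) (add_s₀_ne_zero hs)

theorem cofactor_re_pos {s : ℂ} (hs : ‖s‖ < 1 / 2) : 0 < (cofactor s).re := by
  obtain ⟨h1, h2⟩ := s₀_bounds
  have h3 : cofactor s = (s ^ 2 + ((2 + 2 * s₀ : ℝ) : ℂ) * s) +
      ((3 + 4 * s₀ + 3 * s₀ ^ 2 : ℝ) : ℂ) := by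
    unfold cofactor; push_cast; ring
  have h4 : ‖s ^ 2 + ((2 + 2 * s₀ : ℝ) : ℂ) * s‖ ≤ 2 := by
    refine (norm_add_le _ _).trans ?_
    rw [norm_pow, norm_mul, Complex.norm_real, Real.norm_of_nonneg (by linarith)]
    nlinarith [norm_nonneg s]
  have h5 := (abs_le.1 ((Complex.abs_re_le_norm _).trans h4)).1
  rw [h3, Complex.add_re, Complex.ofReal_re]
  nlinarith

theorem s₀C_ne_zero : (s₀ : ℂ) ≠ 0 := by
  have := s₀_bounds.1
  exact_mod_cast (by linarith : (0 : ℝ) < s₀).ne'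

theorem norm_s₀ : ‖(s₀ : ℂ)‖ = s₀ := by
  rw [Complex.norm_real, Real.norm_of_nonneg (by linarith [s₀_bounds.1])]

theorem s₀_poly_complex : 3 * (s₀ : ℂ) ^ 2 + 4 * s₀ ^ 3 + 3 * s₀ ^ 4 = 1 := by
  exact_mod_cast s₀_poly

theorem norm_lt_half {s : ℂ} (hs : ‖s‖ ≤ s₀) : ‖s‖ < 1 / 2 := hs.trans_lt s₀_bounds.2

theorem z₀C_ne_zero : (z₀ : ℂ) ≠ 0 := by exact_mod_cast z₀_pos.ne'

theorem uOf_sq {s : ℂ} (hs : ‖s‖ < 1 / 2) : uOf s ^ 2 = 1 - zOf s / z₀ := by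
  have hq := quad_ne_zero hs
  have hq₀ : quad (s₀ : ℂ) ≠ 0 := quad_ne_zero (norm_lt_half norm_s₀.le)
  have hs₀ := s₀C_ne_zero
  rw [uOf, div_pow, mul_pow, sqrtC_sq, ← zOf_s₀C, zOf, zOf]
  field_simp
  unfold quad cofactor
  linear_combination (s₀ - s) * s₀_poly_complex

theorem uOf_s₀ : uOf s₀ = 0 := by simp [uOf]

theorem differentiableAt_sqrtC_cofactor_div {s : ℂ} (hs : ‖s‖ < 1 / 2) :
    DifferentiableAt ℂ (fun s => sqrtC (cofactor s) / quad s) s := by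
  have h1 : DifferentiableAt ℂ cofactor s := by unfold cofactor; fun_prop
  have h2 : DifferentiableAt ℂ quad s := by unfold quad; fun_prop
  exact ((differentiableAt_sqrtC (Or.inl (cofactor_re_pos hs))).comp s h1).div h2
    (quad_ne_zero hs)

theorem hasDerivAt_uOf {s : ℂ} (hs : ‖s‖ < 1 / 2) :
    HasDerivAt uOf (-1 * (sqrtC (cofactor s) / quad s) +
      (s₀ - s) * deriv (fun s => sqrtC (cofactor s) / quad s) s) s := by
  have h := ((hasDerivAt_id s).const_sub (s₀ : ℂ)).mul
    (differentiableAt_sqrtC_cofactor_div hs).hasDerivAt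
  refine h.congr_of_eventuallyEq (Eventually.of_forall fun s => ?_)
  simp [uOf, mul_div_assoc]

theorem hasDerivAt_zOf {s : ℂ} (hs : ‖s‖ < 1 / 2) : HasDerivAt zOf (crit s / quad s ^ 3) s := by
  have hq := quad_ne_zero hs
  have h1 : HasDerivAt (quad : ℂ → ℂ) (1 + 2 * s) s := by
    have := ((hasDerivAt_id s).const_add 1).add (hasDerivAt_pow 2 s)
    convert! this using 1
    simp
  convert! (hasDerivAt_id s).div (h1.pow 2) (pow_ne_zero 2 hq) using 1
  simp only [id, Pi.pow_apply]
  field_simp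
  unfold crit quad
  push_cast
  ring

theorem deriv_uOf_ne_zero {s : ℂ} (hs : ‖s‖ ≤ s₀) : deriv uOf s ≠ 0 := by
  have hs' := norm_lt_half hs
  have hq := quad_ne_zero hs'
  by_cases h : s = s₀
  · subst h
    rw [(hasDerivAt_uOf hs').deriv, sub_self, zero_mul, add_zero]
    refine mul_ne_zero (by norm_num) (div_ne_zero (fun h0 => ?_) hq)
    have h1 := cofactor_re_pos hs'
    rw [← sqrtC_sq (cofactor s₀), h0] at h1
    simp at h1
  · intro h0
    have h1 := (hasDerivAt_uOf hs').differentiableAt.hasDerivAt.pow 2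
    have h2 : HasDerivAt (fun s => 1 - zOf s / (z₀ : ℂ)) (-(crit s / quad s ^ 3 / z₀)) s :=
      ((hasDerivAt_zOf hs').div_const _).const_sub 1
    have h3 : (fun s => 1 - zOf s / (z₀ : ℂ)) =ᶠ[𝓝 s] uOf ^ 2 := by
      filter_upwards [(isOpen_lt continuous_norm continuous_const).mem_nhds hs'] with w hw
      exact (uOf_sq hw).symm
    have h4 := h2.unique (h1.congr_of_eventuallyEq h3)
    rw [h0, mul_zero, neg_eq_zero] at h4
    exact div_ne_zero (div_ne_zero (crit_ne_zero hs' h) (pow_ne_zero 3 hq)) z₀C_ne_zero h4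

/-- A complex number of modulus at most `c` whose real part is at least `c` equals `c`. -/
theorem eq_ofReal_of_norm_le {w : ℂ} {c : ℝ} (h1 : ‖w‖ ≤ c) (h2 : c ≤ w.re) : w = c := by
  have h3 : w.re = c := le_antisymm ((Complex.re_le_norm w).trans h1) h2
  have h4 := Complex.sq_norm_sub_sq_re w
  have h5 : w.im ^ 2 ≤ 0 := by
    rw [← h4, h3]
    nlinarith [norm_nonneg w]
  have h6 : w.im = 0 := (pow_eq_zero_iff two_ne_zero).1 (le_antisymm h5 (sq_nonneg _))
  exact Complex.ext h3 (by simpa using h6)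

/-- On the closed disc of radius `s₀` the map `zOf` is injective: two distinct points with the same
image would force equality in the triangle inequality for `3 s₀² + 4 s₀³ + 3 s₀⁴ = 1`. -/
theorem zOf_injOn : Set.InjOn zOf (Metric.closedBall (0 : ℂ) s₀) := by
  intro s hs t ht h
  rw [mem_closedBall_zero_iff] at hs ht
  have hqs := quad_ne_zero (norm_lt_half hs)
  have hqt := quad_ne_zero (norm_lt_half ht)
  by_contra hne
  have h0 : (0 : ℝ) < s₀ := by linarith [s₀_bounds.1]
  have h1 : 3 * (s * t) + 2 * (s * t * s) + 2 * (s * t * t) +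
      (s * t * s * s + s * t * s * t + s * t * t * t) = 1 := by
    apply mul_left_cancel₀ (sub_ne_zero.2 hne)
    rw [zOf, zOf, div_eq_div_iff (pow_ne_zero 2 hqs) (pow_ne_zero 2 hqt)] at h
    unfold quad at h
    linear_combination -h
  have b : ∀ {w v : ℂ} {k : ℕ}, ‖w‖ ≤ s₀ ^ k → ‖v‖ ≤ s₀ → ‖w * v‖ ≤ s₀ ^ (k + 1) := by
    intro w v k hw hv
    rw [norm_mul, pow_succ]
    gcongr
  have b1 : ‖s * t‖ ≤ s₀ ^ 2 := b (k := 1) (by simpa using hs) ht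
  have r : ∀ {w : ℂ} {c : ℝ}, ‖w‖ ≤ c → w.re ≤ c := fun h => (Complex.re_le_norm _).trans h
  have e := congrArg Complex.re h1
  have e3 : ∀ w : ℂ, (3 * w).re = 3 * w.re := fun w => by simp
  have e2 : ∀ w : ℂ, (2 * w).re = 2 * w.re := fun w => by simp
  rw [Complex.add_re, Complex.add_re, Complex.add_re, Complex.add_re, Complex.add_re, e3, e2, e2,
    Complex.one_re] at e
  have c1 := r b1
  have c2 := r (b b1 hs)
  have c3 := r (b b1 ht)
  have c4 := r (b (b b1 hs) hs)
  have c5 := r (b (b b1 hs) ht)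
  have c6 := r (b (b b1 ht) ht)
  norm_num only at c1 c2 c3 c4 c5 c6
  have hp := s₀_poly
  have hst : s * t = ((s₀ ^ 2 : ℝ) : ℂ) := eq_ofReal_of_norm_le b1 (by linarith)
  have key : ∀ w : ℂ, ‖w‖ ≤ s₀ → s₀ ^ 3 ≤ (s * t * w).re → w = s₀ := by
    intro w hw hre
    rw [hst, Complex.re_ofReal_mul, pow_succ] at hre
    exact eq_ofReal_of_norm_le hw (le_of_mul_le_mul_left hre (by positivity))
  exact hne ((key s hs (by linarith)).trans (key t ht (by linarith)).symm)

/-- Parameters exist for all `z` of modulus below `z₀` because the generating functions converge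
there; compactness gives the boundary circle. -/
theorem zOf_surjOn : Set.SurjOn zOf (Metric.closedBall (0 : ℂ) s₀) (Metric.closedBall 0 z₀) := by
  have hc : ContinuousOn zOf (Metric.closedBall (0 : ℂ) s₀) := fun s hs =>
    (hasDerivAt_zOf (norm_lt_half (mem_closedBall_zero_iff.1 hs))).continuousAt.continuousWithinAt
  have hcl := ((isCompact_closedBall (0 : ℂ) s₀).image_of_continuousOn hc).isClosed
  rw [Set.SurjOn, ← closure_ball _ z₀_pos.ne']
  refine hcl.closure_subset_iff.2 fun z hz => ?_
  obtain ⟨s, hs, hsz, -⟩ := hasSum_term_W_mul_Z (mem_ball_zero_iff.1 hz)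
  exact ⟨s, mem_closedBall_zero_iff.2 hs, hsz⟩

theorem uOf_injOn : Set.InjOn uOf (Metric.closedBall (0 : ℂ) s₀) := by
  intro s hs t ht h
  refine zOf_injOn hs ht ?_
  rw [mem_closedBall_zero_iff] at hs ht
  have h1 := uOf_sq (norm_lt_half hs)
  rw [h, uOf_sq (norm_lt_half ht)] at h1
  have h2 : zOf t / (z₀ : ℂ) = zOf s / z₀ := by linear_combination -h1
  exact ((div_left_inj' z₀C_ne_zero).1 h2).symm

theorem zOf_conj (s : ℂ) : zOf (starRingEnd ℂ s) = starRingEnd ℂ (zOf s) := by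
  simp [zOf, quad]

/-- The cut `[z₀, ∞)` is not reached by `zOf` on the closed disc, except at `s₀`. -/
theorem uOf_re_ne_zero {s : ℂ} (hs : ‖s‖ ≤ s₀) (h : s ≠ s₀) : (uOf s).re ≠ 0 := by
  intro h0
  have h1 := uOf_sq (norm_lt_half hs)
  have h2 : uOf s ^ 2 = ((-(uOf s).im ^ 2 : ℝ) : ℂ) := by
    apply Complex.ext <;> simp [pow_two, h0]
  have hz : zOf s = ((z₀ * (1 + (uOf s).im ^ 2) : ℝ) : ℂ) := by
    rw [h2] at h1
    have := z₀C_ne_zero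
    field_simp at h1
    push_cast at h1 ⊢
    linear_combination h1
  -- The real value `zOf s` is also attained at the conjugate of `s`, so `s` is real.
  have hreal : starRingEnd ℂ s = s := by
    refine zOf_injOn (by simpa using hs) (by simpa using hs) ?_
    rw [zOf_conj, hz, Complex.conj_ofReal]
  obtain ⟨x, rfl⟩ := Complex.conj_eq_iff_real.1 hreal
  have hx : ‖x‖ ≤ s₀ := by simpa using hs
  have hx' : x ≠ s₀ := fun h' => h (by rw [h'])
  have h3 : uOf x ^ 2 = (s₀ - x) ^ 2 * cofactor x / quad (x : ℂ) ^ 2 := by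
    rw [uOf, div_pow, mul_pow, sqrtC_sq]
  obtain ⟨c, h4⟩ : ∃ c : ℝ, cofactor x = c :=
    ⟨x ^ 2 + (2 + 2 * s₀) * x + (3 + 4 * s₀ + 3 * s₀ ^ 2), by unfold cofactor; push_cast; ring⟩
  have h5 : quad (x : ℂ) = ((quad x : ℝ) : ℂ) := by simp [quad]
  have h6 := cofactor_re_pos (norm_lt_half hs)
  rw [h4, Complex.ofReal_re] at h6
  have h7 : quad x ≠ 0 := by
    have := quad_ne_zero (norm_lt_half hs)
    rw [h5] at this
    exact_mod_cast this
  have h8 : 0 < (s₀ - x) ^ 2 * c / quad x ^ 2 := by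
    have : s₀ - x ≠ 0 := sub_ne_zero.2 hx'.symm
    positivity
  rw [h2, h4, h5] at h3
  have h9 : -(uOf x).im ^ 2 = (s₀ - x) ^ 2 * c / quad x ^ 2 := by
    exact_mod_cast h3
  nlinarith [sq_nonneg (uOf x).im]

theorem continuousOn_uOf : ContinuousOn uOf (Metric.ball (0 : ℂ) (1 / 2)) := fun _ hs =>
  (hasDerivAt_uOf (mem_ball_zero_iff.1 hs)).continuousAt.continuousWithinAt

theorem uOf_re_pos {s : ℂ} (hs : ‖s‖ ≤ s₀) (h : s ≠ s₀) : 0 < (uOf s).re := by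
  have h0 : (0 : ℝ) < s₀ := by linarith [s₀_bounds.1]
  -- Along the segment from `0` to `s` the real part of `uOf` does not vanish.
  have hseg : ∀ t ∈ Set.Icc (0 : ℝ) 1, ‖(t : ℂ) * s‖ ≤ s₀ ∧ (t : ℂ) * s ≠ s₀ := by
    intro t ht
    have hn : ‖(t : ℂ) * s‖ = t * ‖s‖ := by
      rw [norm_mul, Complex.norm_real, Real.norm_of_nonneg ht.1]
    have h1 : t * ‖s‖ ≤ 1 * ‖s‖ := mul_le_mul_of_nonneg_right ht.2 (norm_nonneg s)
    refine ⟨by rw [hn]; linarith, fun he => ?_⟩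
    have h2 : t * ‖s‖ = s₀ := by rw [← hn, he, norm_s₀]
    have h3 : t = 1 := by
      refine le_antisymm ht.2 (le_of_mul_le_mul_right (a := ‖s‖) ?_ ?_)
      · linarith
      · linarith
    rw [h3, Complex.ofReal_one, one_mul] at he
    exact h he
  have hcont : ContinuousOn (fun t : ℝ => (uOf (t * s)).re) (Set.Icc 0 1) := by
    refine Complex.continuous_re.comp_continuousOn
      (continuousOn_uOf.comp (Continuous.continuousOn (by fun_prop)) fun t ht => ?_)
    exact mem_ball_zero_iff.2 (norm_lt_half (hseg t ht).1)
  have hzero : 0 < (uOf ((0 : ℝ) * s)).re := by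
    have h1 := hseg 0 (by simp)
    refine lt_of_le_of_ne ?_ (uOf_re_ne_zero h1.1 h1.2).symm
    simp only [Complex.ofReal_zero, zero_mul, uOf, sub_zero, quad]
    simpa using mul_nonneg h0.le (sqrtC_re_nonneg (cofactor 0))
  by_contra hneg
  obtain ⟨t, ht, ht'⟩ := intermediate_value_Icc' zero_le_one hcont
    (show (0 : ℝ) ∈ Set.Icc _ _ by
      refine ⟨?_, hzero.le⟩
      simpa using hneg)
  exact uOf_re_ne_zero (hseg t ht).1 (hseg t ht).2 ht'

/-- The image under `uOf` of the closed disc of radius `s₀` contains a lobe of the lemniscate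
domain `‖1 - u ^ 2‖ ≤ 1`, whose node `0` is the image of `s₀`. -/
theorem exists_uOf_eq {u : ℂ} (hu : 0 ≤ u.re) (hu' : ‖1 - u ^ 2‖ ≤ 1) :
    ∃ s : ℂ, ‖s‖ ≤ s₀ ∧ uOf s = u := by
  obtain ⟨s, hs, hsz⟩ := zOf_surjOn (show (z₀ : ℂ) * (1 - u ^ 2) ∈ Metric.closedBall 0 z₀ by
    rw [mem_closedBall_zero_iff, norm_mul, Complex.norm_real, Real.norm_of_nonneg z₀_pos.le]
    nlinarith [z₀_pos])
  rw [mem_closedBall_zero_iff] at hs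
  have h1 := uOf_sq (norm_lt_half hs)
  rw [hsz, mul_div_cancel_left₀ _ z₀C_ne_zero, sub_sub_cancel] at h1
  refine ⟨s, hs, ?_⟩
  rcases sq_eq_sq_iff_eq_or_eq_neg.1 h1 with h | h
  · exact h
  · by_cases hss : s = s₀
    · rw [hss, uOf_s₀] at h ⊢
      exact (neg_eq_zero.1 h.symm).symm
    · have h2 := uOf_re_pos hs hss
      rw [h, Complex.neg_re] at h2
      linarith

/-- An open neighbourhood of a lobe of the lemniscate domain contains a slightly larger lobe. -/
theorem exists_lobe_subset {V : Set ℂ} (hV : IsOpen V)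
    (h : ∀ u : ℂ, 0 ≤ u.re → ‖1 - u ^ 2‖ ≤ 1 → u ∈ V) :
    ∃ ρ : ℝ, 1 < ρ ∧ ∀ u : ℂ, 0 ≤ u.re → ‖1 - u ^ 2‖ < ρ → u ∈ V := by
  set K : Set ℂ := {u | 0 ≤ u.re ∧ ‖1 - u ^ 2‖ ≤ 2 ∧ u ∉ V} with hK
  have hKc : IsCompact K := by
    refine Metric.isCompact_of_isClosed_isBounded ?_ ?_
    · have h2 : IsClosed {u : ℂ | ‖1 - u ^ 2‖ ≤ 2} := isClosed_le (by fun_prop) continuous_const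
      exact (isClosed_le continuous_const Complex.continuous_re).inter
        (h2.inter hV.isClosed_compl)
    · refine (Metric.isBounded_closedBall (x := (0 : ℂ)) (r := 2)).subset fun u hu => ?_
      rw [mem_closedBall_zero_iff]
      have h1 : ‖u‖ ^ 2 ≤ 3 := by
        calc ‖u‖ ^ 2 = ‖1 - (1 - u ^ 2)‖ := by rw [sub_sub_cancel, norm_pow]
          _ ≤ ‖(1 : ℂ)‖ + ‖1 - u ^ 2‖ := norm_sub_le _ _
          _ ≤ 3 := by rw [norm_one]; linarith [hu.2.1]
      nlinarith
  rcases K.eq_empty_or_nonempty with hemp | hne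
  · refine ⟨2, one_lt_two, fun u hu hu' => ?_⟩
    by_contra hV'
    exact (hemp ▸ (show u ∈ K from ⟨hu, hu'.le, hV'⟩) : u ∈ (∅ : Set ℂ))
  · obtain ⟨m, hm, hmin⟩ := hKc.exists_isMinOn hne
      (f := fun u : ℂ => ‖1 - u ^ 2‖) (Continuous.continuousOn (by fun_prop))
    refine ⟨‖1 - m ^ 2‖, ?_, fun u hu hu' => ?_⟩
    · by_contra hle
      exact hm.2.2 (h m hm.1 (not_lt.1 hle))
    · by_contra hV'
      exact (not_le.2 hu') (hmin ⟨hu, hu'.le.trans hm.2.1, hV'⟩)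

theorem sub_div_mem_slitPlane {z : ℂ} {R : ℝ} (hz : z ∈ slitDisc z₀ R) :
    1 - z / z₀ ∈ Complex.slitPlane := by
  by_contra h
  rw [Complex.mem_slitPlane_iff, not_or, not_lt, not_not] at h
  simp only [Complex.sub_re, Complex.sub_im, Complex.div_ofReal_re, Complex.div_ofReal_im,
    Complex.one_re, Complex.one_im] at h
  have := z₀_pos
  refine hz.2 ⟨?_, ?_⟩
  · have h2 := h.2
    field_simp at h2
    linarith
  · have h1 : 1 ≤ z.re / z₀ := by linarith [h.1]
    rwa [one_le_div z₀_pos] at h1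

/-- The inverse of `zOf` on a slit disc reaching beyond the singularity `z₀`. -/
theorem exists_inverse_zOf : ∃ (R : ℝ) (S : ℂ → ℂ), z₀ < R ∧ AnalyticOnNhd ℂ S (slitDisc z₀ R) ∧
    (∀ z ∈ slitDisc z₀ R, ‖S z‖ < 1 / 2 ∧ S z ≠ s₀ ∧ uOf (S z) ^ 2 = 1 - z / z₀) ∧
    (∀ s : ℂ, ‖s‖ ≤ s₀ → ‖zOf s‖ < z₀ → S (zOf s) = s) ∧
    Tendsto S (𝓝[slitDisc z₀ R] (z₀ : ℂ)) (𝓝 (s₀ : ℂ)) := by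
  obtain ⟨V, p, hV, hLV, hp, hpV, hpL⟩ := exists_differentiableOn_inverse Metric.isOpen_ball
    (fun s hs => (hasDerivAt_uOf (mem_ball_zero_iff.1 hs)).differentiableAt.differentiableWithinAt)
    (isCompact_closedBall (0 : ℂ) s₀) (Metric.closedBall_subset_ball s₀_bounds.2) uOf_injOn
    (fun s hs => deriv_uOf_ne_zero (mem_closedBall_zero_iff.1 hs))
  obtain ⟨ρ, hρ, hρV⟩ := exists_lobe_subset hV fun u hu hu' => by
    obtain ⟨s, hs, rfl⟩ := exists_uOf_eq hu hu'
    exact hLV (Set.mem_image_of_mem _ (mem_closedBall_zero_iff.2 hs))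
  have hz₀ := z₀_pos
  have hmem : ∀ z ∈ slitDisc z₀ (ρ * z₀), sqrtC (1 - z / z₀) ∈ V := by
    intro z hz
    refine hρV _ (sqrtC_re_nonneg _) ?_
    rw [sqrtC_sq, sub_sub_cancel, norm_div, Complex.norm_real, Real.norm_of_nonneg hz₀.le,
      div_lt_iff₀ hz₀]
    exact hz.1
  have hopen : IsOpen (slitDisc z₀ (ρ * z₀)) := by
    have hray : IsClosed {z : ℂ | z.im = 0 ∧ z₀ ≤ z.re} :=
      (isClosed_eq Complex.continuous_im continuous_const).inter
        (isClosed_le continuous_const Complex.continuous_re)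
    exact (isOpen_lt continuous_norm continuous_const).inter hray.isOpen_compl
  refine ⟨ρ * z₀, fun z => p (sqrtC (1 - z / z₀)), by nlinarith, ?_, ?_, ?_, ?_⟩
  · refine DifferentiableOn.analyticOnNhd (fun z hz => ?_) hopen
    have h1 := hp.differentiableAt (hV.mem_nhds (hmem z hz))
    have h2 := differentiableAt_sqrtC (sub_div_mem_slitPlane hz)
    have h3 : DifferentiableAt ℂ (fun z : ℂ => 1 - z / (z₀ : ℂ)) z := by fun_prop
    exact (h1.comp z (h2.comp z h3)).differentiableWithinAt
  · intro z hz
    obtain ⟨h1, h2⟩ := hpV _ (hmem z hz)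
    have h3 : uOf (p (sqrtC (1 - z / z₀))) ^ 2 = 1 - z / z₀ := by rw [h2, sqrtC_sq]
    refine ⟨mem_ball_zero_iff.1 h1, fun h => ?_, h3⟩
    rw [show p (sqrtC (1 - z / z₀)) = s₀ from h, uOf_s₀] at h3
    exact Complex.slitPlane_ne_zero (sub_div_mem_slitPlane hz) (by simpa using h3.symm)
  · intro s hs hz
    have h1 : ‖zOf s / (z₀ : ℂ)‖ ≤ 1 := by
      rw [norm_div, Complex.norm_real, Real.norm_of_nonneg hz₀.le, div_le_one hz₀]
      exact hz.le
    obtain ⟨t, ht, htu⟩ := exists_uOf_eq (sqrtC_re_nonneg (1 - zOf s / z₀))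
      (by rwa [sqrtC_sq, sub_sub_cancel])
    have h2 := uOf_sq (norm_lt_half ht)
    rw [htu, sqrtC_sq] at h2
    have h3 : zOf s / (z₀ : ℂ) = zOf t / z₀ := by linear_combination -h2
    have h4 : s = t := zOf_injOn (mem_closedBall_zero_iff.2 hs) (mem_closedBall_zero_iff.2 ht)
      ((div_left_inj' z₀C_ne_zero).1 h3)
    change p (sqrtC (1 - zOf s / z₀)) = s
    rw [← htu, hpL t (mem_closedBall_zero_iff.2 ht), h4]
  · have h0 : (s₀ : ℂ) ∈ Metric.closedBall (0 : ℂ) s₀ := mem_closedBall_zero_iff.2 norm_s₀.le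
    have h1 : Tendsto p (𝓝 0) (𝓝 (s₀ : ℂ)) := by
      have h2 := hLV (Set.mem_image_of_mem uOf h0)
      have h3 := hpL _ h0
      rw [uOf_s₀] at h2 h3
      have h4 := (hp.differentiableAt (hV.mem_nhds h2)).continuousAt.tendsto
      rwa [h3] at h4
    have h2 : Tendsto (fun z : ℂ => 1 - z / (z₀ : ℂ)) (𝓝 (z₀ : ℂ)) (𝓝 0) := by
      have h3 : Continuous fun z : ℂ => 1 - z / (z₀ : ℂ) := by fun_prop
      have h4 := h3.tendsto (z₀ : ℂ)
      rwa [div_self z₀C_ne_zero, sub_self] at h4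
    exact (h1.comp (tendsto_sqrtC_zero.comp h2)).mono_left nhdsWithin_le_nhds

end OrderedTree

/-! ### The singular behaviour -/

namespace OrderedTree

section closedForm

variable {𝕜 : Type*} [Field 𝕜] {s : 𝕜}

theorem solNZ_eq (hq : quad s ≠ 0) (hc : crit s ≠ 0) :
    solNZ s = s * (1 + 2 * s) / (quad s * crit s) := by
  unfold solNZ linZ zOf
  field_simp

theorem solNR_eq (hq : quad s ≠ 0) (hc : crit s ≠ 0) :
    solNR s = s * (1 - s ^ 2) / (quad s * crit s) := by
  unfold solNR linR zOf
  field_simp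
  ring

theorem solDZ_eq (hq : quad s ≠ 0) (hc : crit s ≠ 0) :
    solDZ s = s ^ 2 * (2 + 5 * s + 5 * s ^ 2) / (quad s * crit s ^ 2) := by
  rw [solDZ, linZ, solNZ_eq hq hc, solNR_eq hq hc, solZ, solR]
  field_simp
  ring

theorem solDR_eq (hq : quad s ≠ 0) (hc : crit s ≠ 0) :
    solDR s = s ^ 2 * (1 + 3 * s - s ^ 3) / (quad s * crit s ^ 2) := by
  rw [solDR, linR, solNZ_eq hq hc, solNR_eq hq hc, solZ, solR]
  field_simp
  ring

/-- The polynomial in the numerator of the closed form of `solWZ`. -/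
def numWZ (s : 𝕜) : 𝕜 :=
  2 * s * (2 + 5 * s + 5 * s ^ 2) * (1 + 2 * s) + crit s * (1 + 2 * s) ^ 2 +
    (2 * s * (1 + 3 * s - s ^ 3) * (1 - s ^ 2) + crit s * (1 - s ^ 2) ^ 2) +
    2 * s * (s * (2 + 5 * s + 5 * s ^ 2) * (1 - s ^ 2) + crit s * (1 + 2 * s) * (1 - s ^ 2) +
      s * (1 + 2 * s) * (1 + 3 * s - s ^ 3))

theorem solWZ_eq (hq : quad s ≠ 0) (hc : crit s ≠ 0) :
    solWZ s = s ^ 2 * numWZ s / (quad s * crit s ^ 4) := by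
  rw [solWZ, linZ, inhomWZ, inhomWR, solNZ_eq hq hc, solNR_eq hq hc, solDZ_eq hq hc,
    solDR_eq hq hc, numWZ]
  field_simp
  ring

end closedForm

/-- The product of `solWZ` with the fourth power of `uOf`, with the singular factors cancelled. -/
def regWZ (s : ℂ) : ℂ :=
  s ^ 2 * numWZ s * cofactor s ^ 2 / (81 * (s + s₀ + 1 / 3) ^ 4 * quad s ^ 5)

theorem solWZ_mul_uOf {s : ℂ} (hs : ‖s‖ < 1 / 2) (h : s ≠ s₀) :
    solWZ s * (uOf s ^ 2) ^ 2 = regWZ s := by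
  have hq := quad_ne_zero hs
  have h1 := add_s₀_ne_zero hs
  have h2 : (s₀ : ℂ) - s ≠ 0 := sub_ne_zero.2 h.symm
  have h3 : uOf s ^ 2 = (s₀ - s) ^ 2 * cofactor s / quad s ^ 2 := by
    rw [uOf, div_pow, mul_pow, sqrtC_sq]
  rw [solWZ_eq hq (crit_ne_zero hs h), h3, regWZ, crit_eq]
  generalize s + s₀ + 1 / 3 = w at *
  field_simp
  ring

theorem continuousAt_regWZ : ContinuousAt regWZ s₀ := by
  have hs := norm_lt_half norm_s₀.le
  unfold regWZ
  refine ContinuousAt.div ?_ ?_ (mul_ne_zero (mul_ne_zero (by norm_num)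
    (pow_ne_zero 4 (add_s₀_ne_zero hs))) (pow_ne_zero 5 (quad_ne_zero hs)))
  · unfold numWZ cofactor crit
    fun_prop
  · unfold quad
    fun_prop

/-- The constant of the singular expansion, evaluated in `ℚ(√13)`. -/
theorem regWZ_s₀ : regWZ s₀ = (((91 - 5 * √13) / 1248 : ℝ) : ℂ) := by
  have hs := norm_lt_half norm_s₀.le
  have h13 : √13 = 6 * s₀ + 1 := by unfold s₀; ring
  have hq := quad_ne_zero hs
  have hw := add_s₀_ne_zero hs
  rw [regWZ, div_eq_iff (mul_ne_zero (mul_ne_zero (by norm_num) (pow_ne_zero 4 hw))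
    (pow_ne_zero 5 hq)), h13]
  push_cast
  have p2 : (s₀ : ℂ) ^ 2 = (1 - s₀) / 3 := by linear_combination s₀C_sq / 3
  have p3 : (s₀ : ℂ) ^ 3 = (4 * s₀ - 1) / 9 := by linear_combination (s₀ - 1 / 3) * p2
  have p4 : (s₀ : ℂ) ^ 4 = (4 - 7 * s₀) / 27 := by linear_combination s₀ * p3 + 4 / 9 * p2
  have p5 : (s₀ : ℂ) ^ 5 = (19 * s₀ - 7) / 81 := by linear_combination s₀ * p4 - 7 / 27 * p2
  have p6 : (s₀ : ℂ) ^ 6 = (19 - 40 * s₀) / 243 := by linear_combination s₀ * p5 + 19 / 81 * p2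
  have hcrit : crit (s₀ : ℂ) = 0 := by rw [crit_eq, sub_self]; ring
  have hquad : quad (s₀ : ℂ) = (4 + 2 * s₀) / 3 := by unfold quad; linear_combination p2
  have hcof : cofactor s₀ = 5 + 4 * s₀ := by unfold cofactor; linear_combination 6 * p2
  have hnum : numWZ (s₀ : ℂ) = (746 + 706 * s₀) / 81 := by
    rw [numWZ, hcrit]
    linear_combination 30 * p2 + 48 * p3 + 30 * p4 - 12 * p5 - 12 * p6
  have hw4 : (s₀ + s₀ + 1 / 3 : ℂ) ^ 4 = 169 / 81 := by
    linear_combination 16 * p4 + 32 / 3 * p3 + 8 / 3 * p2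
  rw [hw4, hquad, hcof, hnum]
  ring_nf
  simp only [p2, p3, p4, p5, p6]
  ring

/-- The generating function of `W * Z` extends to a slit disc beyond `z₀`, with a double pole in
`1 - z / z₀` as its leading singular term. -/
theorem exists_extension : ∃ (R : ℝ) (f : ℂ → ℂ), z₀ < R ∧
    (∀ z : ℂ, ‖z‖ < z₀ → HasSum (term (W * Z) z) (f z)) ∧
    AnalyticOnNhd ℂ f (slitDisc z₀ R) ∧
    Tendsto (fun z => f z * (1 - z / z₀) ^ 2) (𝓝[slitDisc z₀ R] (z₀ : ℂ))
      (𝓝 (((91 - 5 * √13) / 1248 : ℝ) : ℂ)) := by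
  obtain ⟨R, S, hR, hS, hS', hinv, hlim⟩ := exists_inverse_zOf
  refine ⟨R, fun z => S z ^ 2 * numWZ (S z) / (quad (S z) * crit (S z) ^ 4), hR, fun z hz => ?_,
    fun z hz => ?_, ?_⟩
  · obtain ⟨s, hs, rfl, hsum⟩ := hasSum_term_W_mul_Z hz
    have hSs := hinv s hs hz
    have hmem : zOf s ∈ slitDisc z₀ R :=
      ⟨hz.trans hR, fun h => (not_lt.2 h.2) ((Complex.re_le_norm _).trans_lt hz)⟩
    obtain ⟨h1, h2, -⟩ := hS' _ hmem
    rw [hSs] at h1 h2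
    beta_reduce
    rwa [hSs, ← solWZ_eq (quad_ne_zero h1) (crit_ne_zero h1 h2)]
  · obtain ⟨h1, h2, -⟩ := hS' z hz
    have h := hS z hz
    have hq := quad_ne_zero h1
    have hc := crit_ne_zero h1 h2
    refine AnalyticAt.div ?_ ?_ (mul_ne_zero hq (pow_ne_zero 4 hc))
    · unfold numWZ crit
      fun_prop
    · unfold quad crit
      fun_prop
  · rw [← regWZ_s₀]
    refine (continuousAt_regWZ.tendsto.comp hlim).congr' ?_
    filter_upwards [self_mem_nhdsWithin] with z hz
    obtain ⟨h1, h2, h3⟩ := hS' z hz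
    rw [← h3, ← solWZ_eq (quad_ne_zero h1) (crit_ne_zero h1 h2), solWZ_mul_uOf h1 h2]
    rfl

end OrderedTree

/-! ### Transfer of a double pole to the coefficients -/

section transfer

/-- Cauchy's estimate for the coefficients of a power series, in the integral form. -/
theorem norm_coeff_mul_pow_le_integral {a : ℕ → ℂ} {g : ℂ → ℂ}
    (h : ∀ w : ℂ, ‖w‖ < 1 → HasSum (fun n => a n * w ^ n) (g w)) {ρ : ℝ} (hρ : 0 < ρ)
    (hρ1 : ρ < 1) (n : ℕ) :
    ‖a n‖ * ρ ^ n ≤ (2 * Real.pi)⁻¹ * ∫ θ in (0 : ℝ)..2 * Real.pi, ‖g (circleMap 0 ρ θ)‖ := by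
  have hball : ∀ y : ℂ, y ∈ Metric.eball (0 : ℂ) 1 ↔ ‖y‖ < 1 := fun y => by
    rw [Metric.mem_eball, edist_zero_right, ← ofReal_norm, ENNReal.ofReal_lt_one]
  have h1 : HasFPowerSeriesOnBall g (FormalMultilinearSeries.ofScalars ℂ a) 0 1 := by
    refine ⟨?_, one_pos, fun {y} hy => ?_⟩
    · refine ENNReal.le_of_forall_nnreal_lt fun r hr => ?_
      refine FormalMultilinearSeries.le_radius_of_summable _ ?_
      have := (h r (by simpa using hr)).summable.norm
      simpa using this
    · rw [zero_add]
      simp only [FormalMultilinearSeries.ofScalars_apply_eq, smul_eq_mul]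
      exact h y ((hball y).1 hy)
  lift ρ to NNReal using hρ.le
  have h2 : DifferentiableOn ℂ g (Metric.closedBall 0 ρ) := by
    refine h1.differentiableOn.mono fun z hz => ?_
    rw [mem_closedBall_zero_iff] at hz
    exact (hball z).2 (hz.trans_lt hρ1)
  have h3 := h1.hasFPowerSeriesAt.eq_formalMultilinearSeries
    (h2.hasFPowerSeriesOnBall hρ).hasFPowerSeriesAt
  have h4 := norm_cauchyPowerSeries_le g 0 ρ n
  rw [← h3, FormalMultilinearSeries.ofScalars_norm, abs_of_pos hρ, inv_pow] at h4
  rwa [← le_div_iff₀ (pow_pos hρ n)]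

/-- The mean of `‖1 - w‖⁻²` over the circle of radius `ρ`, a value of the Poisson integral. -/
theorem integral_inv_norm_sub_sq {ρ : ℝ} (hρ : 0 < ρ) (hρ1 : ρ < 1) :
    (2 * Real.pi)⁻¹ * ∫ θ in (0 : ℝ)..2 * Real.pi, 1 / ‖1 - circleMap 0 ρ θ‖ ^ 2 =
      1 / (1 - ρ ^ 2) := by
  have h1 := (diffContOnCl_const (c := (1 : ℂ))
    (s := Metric.ball (0 : ℂ) 1)).circleAverage_poissonKernel_smul'
    (w := (ρ : ℂ)) (by simpa [abs_of_pos hρ] using hρ1)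
  have h2 : ∀ θ : ℝ, ‖circleMap 0 1 θ - ρ‖ = ‖1 - circleMap 0 ρ θ‖ := by
    intro θ
    have e : (starRingEnd ℂ) (Complex.exp (θ * Complex.I)) * Complex.exp (θ * Complex.I) = 1 := by
      rw [← Complex.exp_conj, ← Complex.exp_add]
      simp
    have e1 : ‖Complex.exp (θ * Complex.I)‖ = 1 := Complex.norm_exp_ofReal_mul_I θ
    calc ‖circleMap 0 1 θ - ρ‖
        = ‖Complex.exp (θ * Complex.I) *
            (starRingEnd ℂ) (1 - circleMap 0 ρ θ)‖ := by
          congr 1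
          simp only [circleMap, map_sub, map_mul, map_one, Complex.conj_ofReal, zero_add,
            Complex.ofReal_one, one_mul]
          linear_combination ρ * e
      _ = ‖1 - circleMap 0 ρ θ‖ := by rw [norm_mul, e1, one_mul, RCLike.norm_conj]
  have h3 : 0 < 1 - ρ ^ 2 := by nlinarith
  rw [Real.circleAverage_def] at h1
  have h4 : ∀ θ : ℝ, ((‖circleMap 0 1 θ - 0‖ ^ 2 - ‖(ρ : ℂ) - 0‖ ^ 2) /
      ‖circleMap 0 1 θ - 0 - ((ρ : ℂ) - 0)‖ ^ 2) • (1 : ℂ) =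
      (((1 - ρ ^ 2) * (1 / ‖1 - circleMap 0 ρ θ‖ ^ 2) : ℝ) : ℂ) := by
    intro θ
    rw [sub_zero, sub_zero, h2]
    simp [div_eq_mul_inv]
  simp only [h4] at h1
  rw [intervalIntegral.integral_ofReal, intervalIntegral.integral_const_mul] at h1
  have h5 : (2 * Real.pi)⁻¹ * ((1 - ρ ^ 2) *
      ∫ θ in (0 : ℝ)..2 * Real.pi, 1 / ‖1 - circleMap 0 ρ θ‖ ^ 2) = 1 := by
    have := congrArg Complex.re h1
    simpa [← Complex.ofReal_pow] using this
  rw [eq_div_iff h3.ne']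
  linarith

/-- Coefficients of a function that is small compared with `‖1 - w‖⁻²`. -/
theorem norm_coeff_mul_pow_le {a : ℕ → ℂ} {g : ℂ → ℂ}
    (h : ∀ w : ℂ, ‖w‖ < 1 → HasSum (fun n => a n * w ^ n) (g w)) {ε C : ℝ}
    (hg : ∀ w : ℂ, ‖w‖ < 1 → ‖g w‖ ≤ ε * (1 / ‖1 - w‖ ^ 2) + C) {ρ : ℝ} (hρ : 0 < ρ)
    (hρ1 : ρ < 1) (n : ℕ) :
    ‖a n‖ * ρ ^ n ≤ ε * (1 / (1 - ρ ^ 2)) + C := by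
  refine (norm_coeff_mul_pow_le_integral h hρ hρ1 n).trans ?_
  rw [← integral_inv_norm_sub_sq hρ hρ1]
  have hc : ∀ θ : ℝ, ‖circleMap 0 ρ θ‖ < 1 := fun θ => by simpa [abs_of_pos hρ] using hρ1
  have hne : ∀ θ : ℝ, 1 - circleMap 0 ρ θ ≠ 0 := fun θ h0 => by
    have := hc θ
    rw [← sub_eq_zero.1 h0, norm_one] at this
    exact lt_irrefl _ this
  have hcont : Continuous fun θ : ℝ => 1 / ‖1 - circleMap 0 ρ θ‖ ^ 2 := by
    refine continuous_const.div (by fun_prop) fun θ => ?_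
    exact pow_ne_zero 2 (norm_ne_zero_iff.2 (hne θ))
  have hi : IntervalIntegrable (fun θ : ℝ => ε * (1 / ‖1 - circleMap 0 ρ θ‖ ^ 2) + C)
      MeasureTheory.volume 0 (2 * Real.pi) :=
    ((hcont.const_mul ε).add continuous_const).intervalIntegrable _ _
  have hle : ∫ θ in (0 : ℝ)..2 * Real.pi, ‖g (circleMap 0 ρ θ)‖ ≤
      ∫ θ in (0 : ℝ)..2 * Real.pi, (ε * (1 / ‖1 - circleMap 0 ρ θ‖ ^ 2) + C) := by
    -- A non-integrable left-hand side has integral `0` by convention.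
    by_cases hgi : IntervalIntegrable (fun θ : ℝ => ‖g (circleMap 0 ρ θ)‖)
        MeasureTheory.volume 0 (2 * Real.pi)
    · exact intervalIntegral.integral_mono_on Real.two_pi_pos.le hgi hi fun θ _ => hg _ (hc θ)
    · rw [intervalIntegral.integral_undef hgi]
      exact intervalIntegral.integral_nonneg Real.two_pi_pos.le fun θ _ =>
        (norm_nonneg _).trans (hg _ (hc θ))
  rw [intervalIntegral.integral_add ((hcont.const_mul ε).intervalIntegrable _ _)
    intervalIntegrable_const, intervalIntegral.integral_const_mul,
    intervalIntegral.integral_const] at hle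
  have hpi := Real.two_pi_pos
  calc _ ≤ (2 * Real.pi)⁻¹ * _ := mul_le_mul_of_nonneg_left hle (by positivity)
    _ = _ := by
      simp only [smul_eq_mul, sub_zero]
      field_simp

/-- If `g` is dominated by `ε ‖1 - w‖⁻²` up to a constant, for every `ε > 0`, its coefficients are
`o(n)`: the bound on the circle of radius `1 - 1 / (2 n)` is averaged. -/
theorem tendsto_coeff_div_zero {a : ℕ → ℂ} {g : ℂ → ℂ}
    (h : ∀ w : ℂ, ‖w‖ < 1 → HasSum (fun n => a n * w ^ n) (g w))
    (hg : ∀ ε : ℝ, 0 < ε → ∃ C : ℝ, ∀ w : ℂ, ‖w‖ < 1 → ‖g w‖ ≤ ε * (1 / ‖1 - w‖ ^ 2) + C) :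
    Tendsto (fun n : ℕ => a n / n) atTop (𝓝 0) := by
  have key : ∀ ε : ℝ, 0 < ε → ∃ C : ℝ, ∀ n : ℕ, 1 ≤ n → ‖a n‖ ≤ 4 * ε * n + C := by
    intro ε hε
    obtain ⟨C, hC⟩ := hg ε hε
    refine ⟨2 * C, fun n hn => ?_⟩
    have hn' : (1 : ℝ) ≤ n := by exact_mod_cast hn
    set x : ℝ := 1 / (2 * n) with hx
    have hx0 : 0 < x := by positivity
    have hx1 : x ≤ 1 / 2 := by
      rw [hx, div_le_div_iff₀ (by positivity) two_pos]
      linarith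
    have hnx : n * x = 1 / 2 := by rw [hx]; field_simp
    have h1 := norm_coeff_mul_pow_le h hC (ρ := 1 - x) (by linarith) (by linarith) n
    have h2 : 1 / 2 ≤ (1 - x) ^ n := by
      have := one_add_mul_le_pow (a := -x) (by linarith) n
      rw [← sub_eq_add_neg 1 x] at this
      linarith
    have h3 : 1 / (1 - (1 - x) ^ 2) ≤ 2 * n := by
      rw [div_le_iff₀ (by nlinarith)]
      nlinarith
    have h4 : ‖a n‖ * (1 / 2) ≤ ‖a n‖ * (1 - x) ^ n :=
      mul_le_mul_of_nonneg_left h2 (norm_nonneg _)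
    have h5 : ε * (1 / (1 - (1 - x) ^ 2)) ≤ ε * (2 * n) := mul_le_mul_of_nonneg_left h3 hε.le
    linarith
  rw [Metric.tendsto_atTop]
  intro δ hδ
  obtain ⟨C, hC⟩ := key (δ / 8) (by positivity)
  obtain ⟨N, hN⟩ := exists_nat_gt (2 * C / δ)
  refine ⟨N + 1, fun n hn => ?_⟩
  have hn1 : 1 ≤ n := by omega
  have hn0 : (0 : ℝ) < n := by exact_mod_cast hn1
  have hNn : (N : ℝ) < n := by exact_mod_cast hn
  have h1 := hC n hn1
  rw [dist_zero_right, norm_div, Complex.norm_natCast, div_lt_iff₀ hn0]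
  have h2 : 2 * C < δ * n := by
    rw [div_lt_iff₀ hδ] at hN
    nlinarith
  linarith

/-- Transfer of a double pole: if a power series with radius of convergence at least `r` extends
continuously to a slit disc of radius `R > r` and behaves like `c / (1 - z / r) ^ 2` near `r`, then
its coefficients satisfy `e n ~ c n r⁻ⁿ`. -/
theorem tendsto_coeff_of_double_pole {e : ℕ → ℂ} {f : ℂ → ℂ} {r R : ℝ} {c : ℂ} (hr : 0 < r)
    (hR : r < R) (hsum : ∀ z : ℂ, ‖z‖ < r → HasSum (fun n => e n * z ^ n) (f z))
    (hf : ContinuousOn f (slitDisc r R))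
    (hlim : Tendsto (fun z => f z * (1 - z / r) ^ 2) (𝓝[slitDisc r R] (r : ℂ)) (𝓝 c)) :
    Tendsto (fun n : ℕ => e n * r ^ n / n) atTop (𝓝 c) := by
  have hrC : (r : ℂ) ≠ 0 := by exact_mod_cast hr.ne'
  have hnr : ‖(r : ℂ)‖ = r := by rw [Complex.norm_real, Real.norm_of_nonneg hr.le]
  have hball : ∀ w : ℂ, ‖w‖ < 1 → ‖r * w‖ < r := fun w hw => by
    rw [norm_mul, hnr]
    nlinarith
  have hmem : ∀ z : ℂ, ‖z‖ ≤ r → z ≠ r → z ∈ slitDisc r R := by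
    refine fun z hz hne => ⟨hz.trans_lt hR, fun h => hne ?_⟩
    have h1 := OrderedTree.eq_ofReal_of_norm_le hz h.2
    exact h1
  -- Subtract `c w / (1 - w) ^ 2`, whose coefficients are exactly `c n`.
  set g : ℂ → ℂ := fun w => f (r * w) - c * (w / (1 - w) ^ 2) with hgdef
  have hg : ∀ w : ℂ, ‖w‖ < 1 → HasSum (fun n => (e n * r ^ n - c * n) * w ^ n) (g w) := by
    intro w hw
    have h1 := hsum _ (hball w hw)
    have h2 := (hasSum_coe_mul_geometric_of_norm_lt_one hw).mul_left c
    refine (h1.sub h2).congr_fun fun n => ?_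
    rw [mul_pow]
    ring
  have hbound : ∀ ε : ℝ, 0 < ε →
      ∃ C : ℝ, ∀ w : ℂ, ‖w‖ < 1 → ‖g w‖ ≤ ε * (1 / ‖1 - w‖ ^ 2) + C := by
    intro ε hε
    have hlim' : Tendsto (fun z => f z * (1 - z / r) ^ 2 - c * (z / r)) (𝓝[slitDisc r R] (r : ℂ))
        (𝓝 0) := by
      have h1 : Tendsto (fun z : ℂ => c * (z / r)) (𝓝[slitDisc r R] (r : ℂ)) (𝓝 c) := by
        have h2 : Continuous fun z : ℂ => c * (z / r) := by fun_prop
        have h3 := (h2.tendsto (r : ℂ)).mono_left (nhdsWithin_le_nhds (s := slitDisc r R))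
        rwa [div_self hrC, mul_one] at h3
      simpa using hlim.sub h1
    have hnear := hlim'.norm.eventually (gt_mem_nhds (by simpa using hε))
    rw [eventually_nhdsWithin_iff, Metric.eventually_nhds_iff] at hnear
    obtain ⟨δ, hδ, hnear⟩ := hnear
    -- Away from `r` the closed disc is a compact subset of the slit disc.
    have hK : IsCompact (Metric.closedBall (0 : ℂ) r \ Metric.ball (r : ℂ) δ) :=
      (isCompact_closedBall _ _).diff Metric.isOpen_ball
    have hgc : ContinuousOn (fun z => f z - c * (z / r / (1 - z / r) ^ 2))
        (Metric.closedBall (0 : ℂ) r \ Metric.ball (r : ℂ) δ) := by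
      have hne : ∀ z ∈ Metric.closedBall (0 : ℂ) r \ Metric.ball (r : ℂ) δ, z ≠ r := by
        rintro z hz rfl
        exact hz.2 (Metric.mem_ball_self hδ)
      refine (hf.mono fun z hz => hmem z (mem_closedBall_zero_iff.1 hz.1) (hne z hz)).sub
        (continuousOn_const.mul (ContinuousOn.div (by fun_prop) (by fun_prop) fun z hz h0 => ?_))
      have h1 : 1 - z / r = 0 := pow_eq_zero_iff two_ne_zero |>.1 h0
      rw [sub_eq_zero, eq_div_iff hrC, one_mul] at h1
      exact hne z hz h1.symm
    obtain ⟨C, hC⟩ := hK.exists_bound_of_continuousOn hgc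
    refine ⟨max C 0, fun w hw => ?_⟩
    have hw1 : 1 - w ≠ 0 := by
      intro h0
      rw [← sub_eq_zero.1 h0, norm_one] at hw
      exact lt_irrefl _ hw
    have hrw : (r : ℂ) * w / r = w := mul_div_cancel_left₀ w hrC
    by_cases hd : dist ((r : ℂ) * w) r < δ
    · have h1 := hnear hd (hmem _ (hball w hw).le fun h0 => by
        have := hball w hw
        rw [h0, hnr] at this
        exact lt_irrefl _ this)
      rw [hrw] at h1
      have h2 : g w = (f (r * w) * (1 - w) ^ 2 - c * w) / (1 - w) ^ 2 := by
        rw [hgdef]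
        field_simp
      rw [h2, norm_div, norm_pow, div_eq_mul_one_div]
      have h3 : ‖f (r * w) * (1 - w) ^ 2 - c * w‖ * (1 / ‖1 - w‖ ^ 2) ≤
          ε * (1 / ‖1 - w‖ ^ 2) := mul_le_mul_of_nonneg_right h1.le (by positivity)
      linarith [le_max_right C 0]
    · have h1 := hC (r * w) ⟨mem_closedBall_zero_iff.2 (hball w hw).le, hd⟩
      rw [hrw] at h1
      have h2 : 0 ≤ ε * (1 / ‖1 - w‖ ^ 2) := by positivity
      linarith [le_max_left C 0]
  have h1 := tendsto_coeff_div_zero hg hbound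
  have h2 := h1.add_const c
  rw [zero_add] at h2
  refine h2.congr' ?_
  filter_upwards [eventually_gt_atTop 0] with n hn
  have : (n : ℂ) ≠ 0 := by exact_mod_cast hn.ne'
  field_simp
  ring

end transfer

/-! ### The number of trees and the expectation -/

/-- Stirling's formula for the central binomial coefficients. -/
theorem tendsto_centralBinom_mul_sqrt_div :
    Tendsto (fun n : ℕ => (n.centralBinom : ℝ) * √n / 4 ^ n) atTop (𝓝 (1 / √Real.pi)) := by
  have hpi : √Real.pi ≠ 0 := (Real.sqrt_pos.2 Real.pi_pos).ne'
  have h1 := Stirling.tendsto_stirlingSeq_sqrt_pi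
  have h2 : Tendsto (fun n : ℕ => Stirling.stirlingSeq (2 * n)) atTop (𝓝 √Real.pi) :=
    h1.comp (tendsto_id.const_mul_atTop' two_pos)
  have h3 := h2.div (h1.pow 2) (pow_ne_zero 2 hpi)
  have h4 : √Real.pi / √Real.pi ^ 2 = 1 / √Real.pi := by field_simp
  rw [h4] at h3
  refine h3.congr' ?_
  filter_upwards [eventually_gt_atTop 0] with n hn
  have hn' : (0 : ℝ) < n := by exact_mod_cast hn
  have hf : ((n.centralBinom : ℕ) : ℝ) * (n.factorial : ℝ) ^ 2 = ((2 * n).factorial : ℝ) := by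
    have := Nat.choose_mul_factorial_mul_factorial (show n ≤ 2 * n by omega)
    rw [show 2 * n - n = n by omega, ← Nat.centralBinom_eq_two_mul_choose] at this
    rw [← this]
    push_cast
    ring
  have hsq : √(2 * (n : ℝ)) ^ 2 = 2 * n := Real.sq_sqrt (by positivity)
  have hsq4 : √(2 * ((2 * n : ℕ) : ℝ)) = 2 * √n := by
    rw [show 2 * ((2 * n : ℕ) : ℝ) = 2 ^ 2 * n by push_cast; ring, Real.sqrt_mul (by positivity),
      Real.sqrt_sq two_pos.le]
  have hs : √(n : ℝ) ^ 2 = n := Real.sq_sqrt hn'.le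
  have hs0 : 0 < √(n : ℝ) := Real.sqrt_pos.2 hn'
  have hnf : (0 : ℝ) < n.factorial := by exact_mod_cast n.factorial_pos
  have he : ((2 * n : ℕ) : ℝ) / Real.exp 1 = 2 * (n / Real.exp 1) := by push_cast; ring
  rw [Pi.div_apply, Stirling.stirlingSeq, Stirling.stirlingSeq, hsq4, ← hf, he, div_pow (n.factorial : ℝ),
    mul_pow √_, hsq, ← pow_mul, mul_comm n 2, mul_pow 2, pow_mul 2 2 n]
  have hx : 0 < (n : ℝ) / Real.exp 1 := by positivity
  generalize (n : ℝ) / Real.exp 1 = x at *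
  norm_num
  rw [div_div_eq_mul_div]
  field_simp
  rw [hs]

/-- Asymptotics of the number of plane trees on `n` vertices, which is `catalan (n - 1)`. -/
theorem tendsto_catalan_pred_mul_div :
    Tendsto (fun n : ℕ => (catalan (n - 1) : ℝ) * (n : ℝ) ^ (3 / 2 : ℝ) / 4 ^ n) atTop
      (𝓝 (1 / (4 * √Real.pi))) := by
  have h1 : Tendsto (fun n : ℕ => 1 / (2 * (2 - 1 / (n : ℝ)))) atTop (𝓝 (1 / (2 * (2 - 0)))) :=
    Tendsto.div tendsto_const_nhds
      ((tendsto_const_nhds.sub tendsto_one_div_atTop_nhds_zero_nat).const_mul 2) (by norm_num)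
  have h2 := tendsto_centralBinom_mul_sqrt_div.mul h1
  have h3 : 1 / √Real.pi * (1 / (2 * (2 - 0))) = 1 / (4 * √Real.pi) := by
    rw [div_mul_div_comm]
    norm_num [mul_comm]
  rw [h3] at h2
  refine h2.congr' ?_
  filter_upwards [eventually_gt_atTop 0] with n hn
  obtain ⟨m, rfl⟩ : ∃ m, n = m + 1 := ⟨n - 1, by omega⟩
  have hc1 : ((m : ℝ) + 1) * catalan m = m.centralBinom := by
    exact_mod_cast succ_mul_catalan_eq_centralBinom m
  have hc2 : ((m : ℝ) + 1) * (m + 1).centralBinom = 2 * (2 * m + 1) * m.centralBinom := by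
    exact_mod_cast Nat.succ_mul_centralBinom_succ m
  have hm : (0 : ℝ) < m + 1 := by positivity
  have hc : ((m + 1).centralBinom : ℝ) = 2 * (2 * m + 1) * catalan m := by
    rw [← hc1] at hc2
    apply mul_left_cancel₀ hm.ne'
    linarith
  have hp : ((m + 1 : ℕ) : ℝ) ^ (3 / 2 : ℝ) = (m + 1) * √((m + 1 : ℕ) : ℝ) := by
    rw [show (3 / 2 : ℝ) = 1 + 1 / 2 by norm_num, Real.rpow_add (by positivity), Real.rpow_one,
      Real.sqrt_eq_rpow]
    push_cast
    rfl
  have hd : 2 - 1 / ((m + 1 : ℕ) : ℝ) = (2 * m + 1) / (m + 1) := by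
    push_cast
    field_simp
    ring
  rw [hp, hd, hc, Nat.add_sub_cancel]
  field_simp

namespace OrderedTree

theorem mem_treesOfOrder {n : ℕ} {T : OrderedTree} : T ∈ treesOfOrder n ↔ T.order = n := by
  simp [treesOfOrder]

/-- Grouping the trees by their number of vertices. -/
theorem hasSum_treesOfOrder {f : OrderedTree → ℕ} {z a : ℂ} (h : HasSum (term f z) a) :
    HasSum (fun n => (∑ T ∈ treesOfOrder n, (f T : ℂ)) * z ^ n) a := by
  refine ((Equiv.sigmaFiberEquiv order).hasSum_iff.2 h).sigma fun n => ?_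
  have h1 := (treesOfOrder n).hasSum (term f z)
  have h2 : ∑ T ∈ treesOfOrder n, term f z T = (∑ T ∈ treesOfOrder n, (f T : ℂ)) * z ^ n := by
    rw [Finset.sum_mul]
    exact Finset.sum_congr rfl fun T hT => by rw [term, mem_treesOfOrder.1 hT]
  rw [h2] at h1
  exact ((Equiv.subtypeEquivRight fun T => (mem_treesOfOrder (n := n) (T := T)).symm).hasSum_iff
    (f := fun T : treesOfOrder n => term f z T)).2 h1

end OrderedTree

theorem inv_z₀ : 1 / (4 * z₀) = (35 + 13 * √13) / 54 := by
  have h := Real.sq_sqrt (show (0 : ℝ) ≤ 13 by norm_num)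
  have hz := OrderedTree.z₀_pos.ne'
  rw [div_eq_div_iff (by positivity) (by norm_num), z₀]
  linear_combination -169 / 18 * h

end

theorem mainTheorem5 :
    (∃ R : ℝ, z₀ < R ∧ ∃ WZ : ℂ → ℂ,
      (∀ z : ℂ, ‖z‖ < z₀ →
        HasSum (fun T : OrderedTree => ((T.W * T.Z : ℕ) : ℂ) * z ^ T.order) (WZ z)) ∧
      AnalyticOnNhd ℂ WZ (slitDisc z₀ R) ∧
      WZ ~[𝓝[slitDisc z₀ R] (z₀ : ℂ)]
        fun z => (((91 - 5 * √13) / 1248 : ℝ) : ℂ) / (1 - z / (z₀ : ℂ)) ^ 2) ∧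
    (fun n : ℕ => OrderedTree.expectation (fun T => (T.W : ℝ) * (T.Z : ℝ)) n) ~[atTop]
      fun n : ℕ => (91 - 5 * √13) * √Real.pi / 312 * (n : ℝ) ^ (5 / 2 : ℝ) *
        ((35 + 13 * √13) / 54) ^ n := by
  obtain ⟨R, f, hR, hsum, han, hlim⟩ := OrderedTree.exists_extension
  have hz₀ := OrderedTree.z₀_pos
  have hcpos : 0 < (91 - 5 * √13) / 1248 := by
    have : √13 < 4 := (Real.sqrt_lt' (by norm_num)).2 (by norm_num)
    linarith
  refine ⟨⟨R, hR, f, hsum, han, ?_⟩, ?_⟩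
  · have hc : (((91 - 5 * √13) / 1248 : ℝ) : ℂ) ≠ 0 := by exact_mod_cast hcpos.ne'
    refine isEquivalent_of_tendsto_one ?_
    have h1 := hlim.div_const (((91 - 5 * √13) / 1248 : ℝ) : ℂ)
    rw [div_self hc] at h1
    refine h1.congr fun z => ?_
    rw [Pi.div_apply, div_div_eq_mul_div]
  · have h1 := tendsto_coeff_of_double_pole hz₀ hR
      (fun z hz => OrderedTree.hasSum_treesOfOrder (hsum z hz)) han.continuousOn hlim
    have h2 : Tendsto (fun n : ℕ => (∑ T ∈ OrderedTree.treesOfOrder n, (T.W : ℝ) * (T.Z : ℝ)) *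
        z₀ ^ n / n) atTop (𝓝 ((91 - 5 * √13) / 1248)) := by
      have h3 := (Complex.continuous_re.tendsto _).comp h1
      rw [Complex.ofReal_re] at h3
      refine h3.congr fun n => ?_
      rw [Function.comp_apply, ← Complex.ofReal_re (_ * z₀ ^ n / n)]
      congr 1
      push_cast [Pi.mul_apply]
      rfl
    have h3 := h2.div tendsto_catalan_pred_mul_div (by positivity)
    have hpi : 0 < √Real.pi := Real.sqrt_pos.2 Real.pi_pos
    refine isEquivalent_of_tendsto_one ?_
    have h4 := h3.div_const ((91 - 5 * √13) / 1248 / (1 / (4 * √Real.pi)))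
    rw [div_self (by positivity)] at h4
    refine h4.congr' ?_
    filter_upwards [eventually_gt_atTop 0] with n hn
    have hn' : (0 : ℝ) < n := by exact_mod_cast hn
    obtain ⟨m, rfl⟩ : ∃ m, n = m + 1 := ⟨n - 1, by omega⟩
    have hp : ((m + 1 : ℕ) : ℝ) ^ (5 / 2 : ℝ) =
        ((m + 1 : ℕ) : ℝ) * ((m + 1 : ℕ) : ℝ) ^ (3 / 2 : ℝ) := by
      rw [show (5 / 2 : ℝ) = 1 + 3 / 2 by norm_num, Real.rpow_add hn', Real.rpow_one]
    have hrp : 0 < ((m + 1 : ℕ) : ℝ) ^ (3 / 2 : ℝ) := Real.rpow_pos_of_pos hn' _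
    simp only [Pi.div_apply]
    rw [OrderedTree.expectation, OrderedTree.card_treesOfOrder_succ, Nat.add_sub_cancel, hp,
      ← inv_z₀, div_pow, one_pow, mul_pow]
    have hc0 : (91 - 5 * √13) ≠ 0 := by
      intro h0
      rw [h0] at hcpos
      simp at hcpos
    have hcat : (catalan m : ℝ) ≠ 0 := by
      intro h0
      have h5 : ((m : ℝ) + 1) * catalan m = m.centralBinom := by
        exact_mod_cast succ_mul_catalan_eq_centralBinom m
      have h6 : (0 : ℝ) < m.centralBinom := by exact_mod_cast m.centralBinom_pos
      rw [h0, mul_zero] at h5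
      exact h6.ne h5
    generalize ((m + 1 : ℕ) : ℝ) ^ (3 / 2 : ℝ) = y at *
    generalize (∑ T ∈ OrderedTree.treesOfOrder (m + 1), (T.W : ℝ) * (T.Z : ℝ)) = e
    generalize ((m + 1 : ℕ) : ℝ) = N at *
    generalize 91 - 5 * √13 = c at *
    field_simp
    ring
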